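/- **Graphs.** A (unit, finite) *time-like graph* (TLG) is a finite directed multigraph $\mathcal G=(\mathcal V,\mathcal E)$ with a time $t_v\in[0,1]$ for each vertex, strictly increasing along each edge, with one vertex at time $0$, one vertex at time $1$, all other vertices at times in $(0,1)$ and having at least one incoming and one outgoing edge. $R(\mathcal G)$ is the topological space obtained by gluing the closed edges (copies of the time intervals $[t_u,t_v]$) at the vertices; its elements are the points of $\mathcal G$. A *time-path* is a directed path of edges; it is *full* if it goes from time $0$ to time $1$. $\mathcal G$ is a *TLG\** if it is the last graph of a *tower*: a finite sequence of TLGs which starts with the graph with two vertices (at times $0$ and $1$) and one edge, and in which each graph arises from the preceding one by subdividing an edge by a new vertex, or by adding a new edge from $u$ to $v$, $t_u<t_v$, where $u$ and $v$ are already connected by a time-path. **Processes.** A *Markov family* $\mathcal M=\{\mu_\sigma\}$ assigns to each full time-path $\sigma$ of $\mathcal G$ the law $\mu_\sigma$ of a Markov process on $[0,1]$ (with values in a measurable space), and it is consistent: for any $\sigma_1,\sigma_2$ the laws $\mu_{\sigma_1}$ and $\mu_{\sigma_2}$ have the same restriction to the set of times at which $\sigma_1$ and $\sigma_2$ pass through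 the same point. A *natural $\mathcal M$-process* $X=(X(t):t\in R(\mathcal G))$ is a process constructed along a tower ending with $\mathcal G$: on the one-edge graph it has the law prescribed by $\mathcal M$; subdividing an edge changes nothing; when an edge $E^*$ from $u$ to $v$ is added to $\mathcal H$, one takes a full time-path $\sigma$ of the enlarged graph through $E^*$ and a regular conditional law $\mu_*(\cdot\mid x,y)$ of the $\mu_\sigma$-distributed process on $[t_u,t_v]$ given the values $x,y$ at $t_u,t_v$, and the conditional law of $X$ on $E^*$ given $X$ on $\mathcal H$ is $\mu_*(\cdot\mid X(u),X(v))$. (Paths of the smaller graphs are identified with paths of $\mathcal G$. The conditional laws exist for instance for real-valued continuous or RCLL processes.) **Moralization.** A *truly simple cell* from $u$ to $v$ is a pair of distinct time-paths from $u$ to $v$ with no common vertex other than $u,v$, such that no path (in any time direction) that avoids $u$ and $v$ and stays in the subgraph $\mathcal G[u,v]$, spanned by the vertices lying on time-paths from $u$ to $v$, connects the interiors of the two. The *moralized graph* $\mathcal G^\heartsuit$ arises from $\mathcal G$ by adding an edge from $u$ to $v$ for each pair $(u,v)$ which is the beginning and the end of a truly simple cell; so $R(\mathcal G)\subset R(\mathcal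 G^\heartsuit)$. **Theorem.** Let $\mathcal G$ be a TLG\*, $\mathcal M$ a Markov family on $\mathcal G$, and $X$ a natural $\mathcal M$-process on $\mathcal G$. Then $X$ is moralized graph-Markovian: whenever $W\subset R(\mathcal G)$ is finite and non-empty and $R(\mathcal G^\heartsuit)\setminus W=U_1\cup U_2$ with $U_1,U_2$ disjoint, non-empty and open, the families $(X(t):t\in R(\mathcal G)\cap(U_1\cup W))$ and $(X(t):t\in R(\mathcal G)\cap(U_2\cup W))$ are conditionally independent given $(X(t):t\in W)$. -/

import Mathlib

open MeasureTheory ProbabilityTheory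

noncomputable section

/-! ### Conditional independence and Markov laws -/

/-- `m₁` and `m₂` are conditionally independent given `m'` under `P`:
`P(A ∩ B | m') = P(A | m') P(B | m')` almost surely, for all `A ∈ m₁` and `B ∈ m₂`.
(Mathlib's `CondIndep` is this property, but restricted to standard Borel sample spaces.) -/
def CondIndepGiven {Ω : Type*} [MeasurableSpace Ω] (P : Measure Ω)
    (m₁ m₂ m' : MeasurableSpace Ω) : Prop :=
  ∀ A B : Set Ω, MeasurableSet[m₁] A → MeasurableSet[m₂] B →
    P⟦A ∩ B | m'⟧ =ᵐ[P] P⟦A | m'⟧ * P⟦B | m'⟧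

/-- The σ-algebra `σ(X_t : t ∈ A)`. -/
@[reducible] def sigmaOn {Ω T S : Type*} [MeasurableSpace S] (X : T → Ω → S) (A : Set T) :
    MeasurableSpace Ω :=
  ⨆ t ∈ A, MeasurableSpace.comap (X t) inferInstance

/-- `μ` is the law of a Markov process indexed by `[0,1]`: it is a probability measure, and under
it past and future are conditionally independent given the present. -/
structure IsMarkovLaw {S : Type*} [MeasurableSpace S] (μ : Measure (unitInterval → S)) : Prop where
  prob : IsProbabilityMeasure μ
  markov : ∀ t : unitInterval,
    CondIndepGiven μ (sigmaOn (fun (s : unitInterval) y => y s) (Set.Iic t))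
      (sigmaOn (fun (s : unitInterval) y => y s) (Set.Ici t))
      (sigmaOn (fun (s : unitInterval) y => y s) {t})

/-! ### Time-like graphs -/

/-- A (unit, finite) time-like graph. Distinct vertices may have the same time, and parallel edges
are allowed. The edge `e` goes from `src e` to `tgt e`, forward in time. -/
structure TLG where
  V : Type
  E : Type
  finV : Finite V
  finE : Finite E
  time : V → unitInterval
  src : E → V
  tgt : E → V
  start : V
  final : V
  time_start : time start = 0
  time_final : time final = 1
  time_pos : ∀ v, v ≠ start → v ≠ final → 0 < time v
  time_lt_one : ∀ v, v ≠ start → v ≠ final → time v < 1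
  time_lt : ∀ e, time (src e) < time (tgt e)
  exists_in : ∀ v, v ≠ start → v ≠ final → ∃ e, tgt e = v
  exists_out : ∀ v, v ≠ start → v ≠ final → ∃ e, src e = v

namespace TLG

/-- Points of (the representation of) a time-like graph: the vertices, and the points in the
interior of the edges, given by the edge and the time. -/
inductive Point (G : TLG) : Type
  | vertex (v : G.V) : Point G
  | inner (e : G.E) (τ : Set.Ioo (G.time (G.src e)) (G.time (G.tgt e))) : Point G

/-- The point of the closed edge `e` at time `τ` (its first or last point if `τ` is outside the
time interval of `e`). -/
def edgePoint (G : TLG) (e : G.E) (τ : unitInterval) : G.Point :=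
  if h₁ : τ ≤ G.time (G.src e) then .vertex (G.src e)
  else if h₂ : G.time (G.tgt e) ≤ τ then .vertex (G.tgt e)
  else .inner e ⟨τ, not_le.1 h₁, not_le.1 h₂⟩

/-- The closed edges, glued at the vertices: the quotient topology. -/
instance (G : TLG) : TopologicalSpace G.Point :=
  ⨆ e : G.E, TopologicalSpace.coinduced
    (fun τ : Set.Icc (G.time (G.src e)) (G.time (G.tgt e)) => G.edgePoint e τ) inferInstance

/-- `G.IsTimePath u l v`: the list of edges `l` is a time-path from `u` to `v` (the empty list is
the trivial path from `u` to `u`). -/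
def IsTimePath (G : TLG) : G.V → List G.E → G.V → Prop
  | u, [], v => u = v
  | u, e :: l, v => G.src e = u ∧ G.IsTimePath (G.tgt e) l v

/-- Full time-paths: time-paths from time `0` to time `1`. -/
def FullPath (G : TLG) : Type :=
  {l : List G.E // G.IsTimePath G.start l G.final}

/-- The point at time `t` on the path `l`. -/
def pointOn (G : TLG) : List G.E → unitInterval → G.Point
  | [], _ => .vertex G.final
  | e :: l, t => if t ≤ G.time (G.tgt e) then G.edgePoint e t else G.pointOn l t

/-- The point at time `t` on the full time-path `σ`. -/
def FullPath.point {G : TLG} (σ : G.FullPath) (t : unitInterval) : G.Point :=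
  G.pointOn σ.1 t

/-! ### Truly simple cells and moralization -/

/-- The vertices of the interval graph `G[u, v]`: those which lie on a time-path from `u`
to `v`. -/
def intervalV (G : TLG) (u v : G.V) : Set G.V :=
  {w | (∃ l, G.IsTimePath u l w) ∧ ∃ l, G.IsTimePath w l v}

/-- The vertices on the path `l`, other than its endpoints `u` and `v`. -/
def innerV (G : TLG) (u v : G.V) (l : List G.E) : Set G.V :=
  {w | (∃ e ∈ l, w = G.src e ∨ w = G.tgt e) ∧ w ≠ u ∧ w ≠ v}

/-- Some edge, in one of the two directions, joins `a` to `b` in `G[u, v]` with its endpoints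
`u` and `v` removed. -/
def IntervalAdj (G : TLG) (u v a b : G.V) : Prop :=
  (a ∈ G.intervalV u v ∧ a ≠ u ∧ a ≠ v) ∧ (b ∈ G.intervalV u v ∧ b ≠ u ∧ b ≠ v) ∧
    ∃ e, (G.src e = a ∧ G.tgt e = b) ∨ (G.src e = b ∧ G.tgt e = a)

/-- A cell: two distinct time-paths from `u` to `v` with no common inner vertex. -/
structure IsCell (G : TLG) (u v : G.V) (l₁ l₂ : List G.E) : Prop where
  path₁ : G.IsTimePath u l₁ v
  path₂ : G.IsTimePath u l₂ v
  ne : l₁ ≠ l₂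
  disjoint : Disjoint (G.innerV u v l₁) (G.innerV u v l₂)

/-- A truly simple cell: no path in `G[u, v]` (not necessarily a time-path, and not passing through
`u` or `v`) connects the interiors of the two sides. A side which is a single edge has no inner
vertex; its interior then is not connected to anything else. -/
structure IsTrulySimpleCell (G : TLG) (u v : G.V) (l₁ l₂ : List G.E) : Prop
    extends G.IsCell u v l₁ l₂ where
  separated : ∀ a ∈ G.innerV u v l₁, ∀ b ∈ G.innerV u v l₂,
    ¬ Relation.ReflTransGen (G.IntervalAdj u v) a b

lemma IsTimePath.eq_or_lt {G : TLG} {u v : G.V} {l : List G.E} (h : G.IsTimePath u l v) :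
    l = [] ∨ G.time u < G.time v := by
  induction l generalizing u with
  | nil => exact Or.inl rfl
  | cons e l ih =>
    obtain ⟨rfl, h⟩ := h
    right
    rcases ih h with rfl | h'
    · cases h
      exact G.time_lt e
    · exact (G.time_lt e).trans h'

lemma IsCell.time_lt {G : TLG} {u v : G.V} {l₁ l₂ : List G.E} (h : G.IsCell u v l₁ l₂) :
    G.time u < G.time v := by
  rcases h.path₁.eq_or_lt with h₁ | h₁
  · rcases h.path₂.eq_or_lt with h₂ | h₂
    · exact absurd (h₁.trans h₂.symm) h.ne
    · exact h₂
  · exact h₁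

/-- The moralized graph: one new edge is added from `u` to `v` whenever `u` and `v` are the
beginning and the end of a truly simple cell. -/
def moral (G : TLG) : TLG where
  V := G.V
  E := G.E ⊕ {p : G.V × G.V // ∃ l₁ l₂, G.IsTrulySimpleCell p.1 p.2 l₁ l₂}
  finV := G.finV
  finE := by
    have := G.finV
    have := G.finE
    infer_instance
  time := G.time
  src := Sum.elim G.src fun p => p.1.1
  tgt := Sum.elim G.tgt fun p => p.1.2
  start := G.start
  final := G.final
  time_start := G.time_start
  time_final := G.time_final
  time_pos := G.time_pos
  time_lt_one := G.time_lt_one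
  time_lt := by
    rintro (e | ⟨p, l₁, l₂, h⟩)
    · exact G.time_lt e
    · exact h.toIsCell.time_lt
  exists_in := fun v h₁ h₂ => by
    obtain ⟨e, he⟩ := G.exists_in v h₁ h₂
    exact ⟨Sum.inl e, he⟩
  exists_out := fun v h₁ h₂ => by
    obtain ⟨e, he⟩ := G.exists_out v h₁ h₂
    exact ⟨Sum.inl e, he⟩

/-- The inclusion of a time-like graph in its moralization. -/
def toMoral (G : TLG) : G.Point → G.moral.Point
  | .vertex v => .vertex (G := G.moral) v
  | .inner e τ => .inner (G := G.moral) (Sum.inl e) τ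

/-! ### Towers: adding vertices and edges -/

/-- The minimal graph: the vertices at times `0` and `1` and one edge between them. -/
structure IsMinimal (G : TLG) : Prop where
  vertices : ∀ v, v = G.start ∨ v = G.final
  edges : ∃ e, G.src e = G.start ∧ G.tgt e = G.final ∧ ∀ f, f = e

/-- `G` is obtained from `H` by adding a vertex: the edge `split` of `H` is replaced by two edges,
from its source to the new vertex `onV none` and from there to its target. -/
structure VertexStep (H G : TLG) where
  split : H.E
  onV : Option H.V ≃ G.V
  onE : {f : H.E // f ≠ split} ⊕ Bool ≃ G.E
  start_eq : G.start = onV (some H.start)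
  final_eq : G.final = onV (some H.final)
  time_eq : ∀ v, G.time (onV (some v)) = H.time v
  src_old : ∀ f, G.src (onE (Sum.inl f)) = onV (some (H.src f))
  tgt_old : ∀ f, G.tgt (onE (Sum.inl f)) = onV (some (H.tgt f))
  src_fst : G.src (onE (Sum.inr false)) = onV (some (H.src split))
  tgt_fst : G.tgt (onE (Sum.inr false)) = onV none
  src_snd : G.src (onE (Sum.inr true)) = onV none
  tgt_snd : G.tgt (onE (Sum.inr true)) = onV (some (H.tgt split))

/-- `G` is obtained from `H` by adding the new edge `onE none` between two vertices `u`, `v` which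
are connected by a time-path in `H`. -/
structure EdgeStep (H G : TLG) where
  u : H.V
  v : H.V
  path : List H.E
  isTimePath : H.IsTimePath u path v
  onV : H.V ≃ G.V
  onE : Option H.E ≃ G.E
  start_eq : G.start = onV H.start
  final_eq : G.final = onV H.final
  time_eq : ∀ v, G.time (onV v) = H.time v
  src_old : ∀ f, G.src (onE (some f)) = onV (H.src f)
  tgt_old : ∀ f, G.tgt (onE (some f)) = onV (H.tgt f)
  src_new : G.src (onE none) = onV u
  tgt_new : G.tgt (onE none) = onV v

/-- A tower which starts with a minimal graph and ends with `G`. -/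
inductive Tower : TLG → Type 1
  | minimal {G : TLG} (h : G.IsMinimal) : Tower G
  | addVertex {H G : TLG} (T : Tower H) (s : VertexStep H G) : Tower G
  | addEdge {H G : TLG} (T : Tower H) (s : EdgeStep H G) : Tower G

/-- The TLG* family. -/
def IsTLGStar (G : TLG) : Prop := Nonempty (Tower G)

lemma IsTimePath.append {G : TLG} {u v w : G.V} {l l' : List G.E} (h : G.IsTimePath u l v)
    (h' : G.IsTimePath v l' w) : G.IsTimePath u (l ++ l') w := by
  induction l generalizing u with
  | nil => cases h; exact h'
  | cons e l ih => exact ⟨h.1, ih h.2⟩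

namespace VertexStep

variable {H G : TLG} (s : VertexStep H G)

open Classical in
/-- The edges of `G` which cover the edge `f` of `H`. -/
def cover (f : H.E) : List G.E :=
  if h : f = s.split then [s.onE (Sum.inr false), s.onE (Sum.inr true)]
  else [s.onE (Sum.inl ⟨f, h⟩)]

/-- The identification of the points of `H` with the points of `G`. -/
def toPoint : H.Point → G.Point
  | .vertex v => .vertex (s.onV (some v))
  | .inner f τ => G.pointOn (s.cover f) τ

lemma isTimePath_cover (f : H.E) :
    G.IsTimePath (s.onV (some (H.src f))) (s.cover f) (s.onV (some (H.tgt f))) := by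
  unfold cover
  split_ifs with h
  · subst h
    exact ⟨s.src_fst, s.src_snd.trans s.tgt_fst.symm, s.tgt_snd⟩
  · exact ⟨s.src_old _, s.tgt_old _⟩

lemma isTimePath_flatMap {u v : H.V} {l : List H.E} (h : H.IsTimePath u l v) :
    G.IsTimePath (s.onV (some u)) (l.flatMap s.cover) (s.onV (some v)) := by
  induction l generalizing u with
  | nil => cases h; rfl
  | cons e l ih =>
    obtain ⟨rfl, h⟩ := h
    exact (s.isTimePath_cover e).append (ih h)

/-- The full time-path of `G` with the same points as the full time-path `σ` of `H`. -/
def toFullPath (σ : H.FullPath) : G.FullPath :=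
  ⟨σ.1.flatMap s.cover, by
    rw [s.start_eq, s.final_eq]
    exact s.isTimePath_flatMap σ.2⟩

end VertexStep

namespace EdgeStep

variable {H G : TLG} (s : EdgeStep H G)

/-- The inclusion of the points of `H` in the points of `G`. -/
def toPoint : H.Point → G.Point
  | .vertex v => .vertex (s.onV v)
  | .inner f τ => G.edgePoint (s.onE (some f)) τ

lemma isTimePath_map {u v : H.V} {l : List H.E} (h : H.IsTimePath u l v) :
    G.IsTimePath (s.onV u) (l.map fun f => s.onE (some f)) (s.onV v) := by
  induction l generalizing u with
  | nil => cases h; rfl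
  | cons e l ih =>
    obtain ⟨rfl, h⟩ := h
    refine ⟨s.src_old e, ?_⟩
    rw [s.tgt_old]
    exact ih h

/-- The full time-path `σ` of `H`, as a full time-path of `G`. -/
def toFullPath (σ : H.FullPath) : G.FullPath :=
  ⟨σ.1.map fun f => s.onE (some f), by
    rw [s.start_eq, s.final_eq]
    exact s.isTimePath_map σ.2⟩

end EdgeStep

/-! ### Processes indexed by a time-like graph -/

/-- A family of laws on `[0,1]`, one for each full time-path. -/
abbrev PathFamily (G : TLG) (S : Type*) [MeasurableSpace S] :=
  G.FullPath → Measure (unitInterval → S)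

/-- Consistency: the laws along two full time-paths have the same restriction to the set of times
at which the two paths pass through the same point. -/
def IsConsistent {G : TLG} {S : Type*} [MeasurableSpace S] (M : G.PathFamily S) : Prop :=
  ∀ σ₁ σ₂ : G.FullPath,
    (M σ₁).map (Set.domRestrict {t | σ₁.point t = σ₂.point t}) =
      (M σ₂).map (Set.domRestrict {t | σ₁.point t = σ₂.point t})

/-- A Markov family: a consistent family of laws of Markov processes. -/
structure IsMarkovFamily {G : TLG} {S : Type*} [MeasurableSpace S] (M : G.PathFamily S) :
    Prop where
  consistent : IsConsistent M
  markov : ∀ σ, IsMarkovLaw (M σ)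

/-- The law of the process on the new edge `e` of `G`, given the process on `H`: for a full
time-path `σ` through `e`, and `κ` a conditional law, given the values at the times of the
endpoints of `e`, of the `M σ`-distributed process on the time interval of `e`, the process `X` on
`e` given `X` on `H` has law `κ (X(u), X(v))`. -/
def EdgeStep.NewEdgeLaw {H G : TLG} (s : EdgeStep H G) {S : Type*} [MeasurableSpace S]
    {Ω : Type*} [MeasurableSpace Ω] (P : Measure Ω) (M : G.PathFamily S)
    (X : G.Point → Ω → S) : Prop :=
  ∃ σ : G.FullPath, s.onE none ∈ σ.1 ∧
  ∃ κ : Kernel (S × S) (Set.Icc (H.time s.u) (H.time s.v) → S), IsMarkovKernel κ ∧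
    (M σ).map (fun y => ((y (H.time s.u), y (H.time s.v)),
        Set.domRestrict (Set.Icc (H.time s.u) (H.time s.v)) y)) =
      ((M σ).map fun y => (y (H.time s.u), y (H.time s.v))) ⊗ₘ κ ∧
    P.map (fun ω => ((fun p : H.Point => X (s.toPoint p) ω),
        fun t : Set.Icc (H.time s.u) (H.time s.v) => X (G.edgePoint (s.onE none) t) ω)) =
      (P.map fun ω (p : H.Point) => X (s.toPoint p) ω) ⊗ₘ
        κ.comap (fun x : H.Point → S => (x (.vertex s.u), x (.vertex s.v))) (by fun_prop)

/-- `X` is the process constructed along the tower `T` from the family `M`. On the minimal graph it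
has the law prescribed by `M`; nothing changes when a vertex is added; when an edge is added, the
process on it has the conditional law given its values at the endpoints. The families on the lower
graphs of the tower are those induced by `M`. -/
def Tower.IsConstructed {S : Type*} [MeasurableSpace S] {Ω : Type*} [MeasurableSpace Ω]
    (P : Measure Ω) : {G : TLG} → Tower G → G.PathFamily S → (G.Point → Ω → S) → Prop
  | _, .minimal _, M, X => ∀ σ, P.map (fun ω t => X (σ.point t) ω) = M σ
  | _, .addVertex T s, M, X =>
      T.IsConstructed P (fun σ => M (s.toFullPath σ)) (fun p => X (s.toPoint p))
  | _, .addEdge T s, M, X =>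
      T.IsConstructed P (fun σ => M (s.toFullPath σ)) (fun p => X (s.toPoint p)) ∧
        s.NewEdgeLaw P M X

/-- A natural `M`-process on `G`: a process constructed from `M` along some tower ending with
`G`. -/
def IsNaturalProcess {G : TLG} {S : Type*} [MeasurableSpace S] {Ω : Type*} [MeasurableSpace Ω]
    (P : Measure Ω) (M : G.PathFamily S) (X : G.Point → Ω → S) : Prop :=
  ∃ T : Tower G, T.IsConstructed P M X

/-- The moralized graph-Markovian property: if the finite non-empty set `W` of points of `G`
separates the moralized graph into two non-empty parts `U₁` and `U₂`, then `X` on the part of `G`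
in `U₁ ∪ W` and `X` on the part of `G` in `U₂ ∪ W` are conditionally independent given `X` on
`W`. -/
def IsMoralizedGraphMarkovian {G : TLG} {S : Type*} [MeasurableSpace S] {Ω : Type*}
    [MeasurableSpace Ω] (P : Measure Ω) (X : G.Point → Ω → S) : Prop :=
  ∀ (W : Set G.Point) (U₁ U₂ : Set G.moral.Point), W.Finite → W.Nonempty →
    IsOpen U₁ → IsOpen U₂ → U₁.Nonempty → U₂.Nonempty → Disjoint U₁ U₂ →
    U₁ ∪ U₂ = (G.toMoral '' W)ᶜ →
    CondIndepGiven P (sigmaOn X (G.toMoral ⁻¹' U₁ ∪ W)) (sigmaOn X (G.toMoral ⁻¹' U₂ ∪ W))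
      (sigmaOn X W)

end TLG

end

/-! ### Conditional independence -/

section CondIndepGiven

variable {Ω : Type*} {m m₁ m₂ m₃ m' n n₁ n₂ mΩ : MeasurableSpace Ω} {P : Measure Ω}

/-! The proof is an induction along the tower. The topology of the moralized graph is first replaced
by a combinatorial condition on the graph itself, `Separates`: the finite set W meets every edge
between a point of U₁ and a point of U₂, and no truly simple cell has its beginning in one of these
sets and its end in the other. Connectedness of the old edges gives the first clause and
connectedness of the added edges the second (`separates_of_moral`).

This condition descends the tower, because a truly simple cell stays truly simple when a vertex or
an edge is added (`isTrulySimpleCell_flatMap`, `isTrulySimpleCell_map`). For an edge the reason is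
that its endpoints were already joined by a time-path, so it connects nothing that was not connected
before.

When an edge from u to v is added to H, it forms a truly simple cell together with the old path from
u to v (`isTrulySimpleCell_new`). Hence u and v both lie in U₁ ∪ W or both lie in U₂ ∪ W. Three
independences are then available: H is split by the induction hypothesis, the new edge is split by
the one-dimensional Markov property (`condIndepOn_of_markov`), and H is independent of the new edge
given the values at u and v (`condIndepOn_new`). Since the interface {u, v} is not itself split, the
rules of weak union and contraction combine the three (`CondIndepOn.glue`).

The Markov property along the new edge requires that X have the prescribed law on every full path,
not only on those used in the construction (`Tower.IsConstructed.map_point`). This is a second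
induction. A path through the new edge agrees, outside the time interval of the edge, with a detour
in H; the Markov property and consistency show that under the prescribed law the edge has the same
conditional law given the rest of the path as in the construction. -/

lemma setIntegral_indicator_one {A B : Set Ω} (hA : MeasurableSet A) :
    ∫ ω in B, A.indicator (fun _ => (1 : ℝ)) ω ∂P = P.real (B ∩ A) := by
  rw [setIntegral_indicator hA]
  simp

lemma integrable_mul_indicator_one {f : Ω → ℝ} (hf : Integrable f P) {B : Set Ω}
    (hB : MeasurableSet B) : Integrable (f * B.indicator fun _ => (1 : ℝ)) P := by
  have : f * (B.indicator fun _ => (1 : ℝ)) = B.indicator f := by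
    ext ω
    by_cases h : ω ∈ B <;> simp [h]
  rw [this]
  exact hf.indicator hB

lemma setIntegral_mul_indicator_one {f : Ω → ℝ} {B C : Set Ω} (hB : MeasurableSet B) :
    ∫ ω in C, (f * B.indicator fun _ => (1 : ℝ)) ω ∂P = ∫ ω in B ∩ C, f ω ∂P := by
  have : f * (B.indicator fun _ => (1 : ℝ)) = B.indicator f := by
    ext ω
    by_cases h : ω ∈ B <;> simp [h]
  rw [this, setIntegral_indicator hB, Set.inter_comm]

lemma sup_eq_generateFrom_inter (m₁ m₂ : MeasurableSpace Ω) :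
    m₁ ⊔ m₂ = MeasurableSpace.generateFrom
      {s | ∃ B C, MeasurableSet[m₁] B ∧ MeasurableSet[m₂] C ∧ s = B ∩ C} := by
  apply le_antisymm
  · refine sup_le (fun B hB => ?_) (fun C hC => ?_)
    · exact MeasurableSpace.measurableSet_generateFrom
        ⟨B, Set.univ, hB, MeasurableSet.univ, by simp⟩
    · exact MeasurableSpace.measurableSet_generateFrom
        ⟨Set.univ, C, MeasurableSet.univ, hC, by simp⟩
  · refine MeasurableSpace.generateFrom_le ?_
    rintro _ ⟨B, C, hB, hC, rfl⟩
    exact MeasurableSet.inter (le_sup_left (a := m₁) (b := m₂) B hB)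
      (le_sup_right (a := m₁) (b := m₂) C hC)

lemma isPiSystem_inter (m₁ m₂ : MeasurableSpace Ω) :
    IsPiSystem {s | ∃ B C, MeasurableSet[m₁] B ∧ MeasurableSet[m₂] C ∧ s = B ∩ C} := by
  rintro _ ⟨B, C, hB, hC, rfl⟩ _ ⟨B', C', hB', hC', rfl⟩ -
  exact ⟨B ∩ B', C ∩ C', hB.inter hB', hC.inter hC', Set.inter_inter_inter_comm _ _ _ _⟩

lemma CondIndepGiven.symm (h : CondIndepGiven P m₁ m₂ m') :
    CondIndepGiven P m₂ m₁ m' := by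
  intro A B hA hB
  rw [Set.inter_comm, mul_comm]
  exact h B A hB hA

lemma CondIndepGiven.mono (h : CondIndepGiven P m₁ m₂ m')
    (h₁ : n₁ ≤ m₁) (h₂ : n₂ ≤ m₂) : CondIndepGiven P n₁ n₂ m' :=
  fun A B hA hB => h A B (h₁ _ hA) (h₂ _ hB)

variable [IsProbabilityMeasure P]

lemma integrable_indicator_one {A : Set Ω} (hA : MeasurableSet A) :
    Integrable (A.indicator fun _ => (1 : ℝ)) P :=
  (integrable_const 1).indicator hA

/-- A version of the conditional probability given `m`. -/
lemma ae_eq_condProb (hm : m ≤ mΩ) {A : Set Ω} (hA : MeasurableSet A)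
    {g : Ω → ℝ} (hg : StronglyMeasurable[m] g) (hgi : Integrable g P)
    (h : ∀ C, MeasurableSet[m] C → ∫ ω in C, g ω ∂P = P.real (C ∩ A)) :
    g =ᵐ[P] P⟦A | m⟧ := by
  refine ae_eq_condExp_of_forall_setIntegral_eq hm (integrable_indicator_one hA)
    (fun s _ _ => hgi.integrableOn) (fun s hs _ => ?_) hg.aestronglyMeasurable
  rw [h s hs, setIntegral_indicator_one hA]

/-- A version of the conditional probability given `m₁ ⊔ m₂`. -/
lemma ae_eq_condProb_sup (h₁ : m₁ ≤ mΩ) (h₂ : m₂ ≤ mΩ) {A : Set Ω}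
    (hA : MeasurableSet A) {g : Ω → ℝ} (hg : StronglyMeasurable[m₁ ⊔ m₂] g)
    (hgi : Integrable g P)
    (h : ∀ B C, MeasurableSet[m₁] B → MeasurableSet[m₂] C →
      ∫ ω in B ∩ C, g ω ∂P = P.real ((B ∩ C) ∩ A)) :
    g =ᵐ[P] P⟦A | m₁ ⊔ m₂⟧ := by
  have hm : m₁ ⊔ m₂ ≤ mΩ := sup_le h₁ h₂
  have huniv : ∫ ω, g ω ∂P = ∫ ω, A.indicator (fun _ => (1 : ℝ)) ω ∂P := by
    have := h Set.univ Set.univ MeasurableSet.univ MeasurableSet.univ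
    rw [← setIntegral_indicator_one hA] at this
    simpa only [Set.univ_inter, Measure.restrict_univ] using this
  refine ae_eq_condProb hm hA hg hgi fun s hs => ?_
  rw [← setIntegral_indicator_one hA]
  have hAi : Integrable (A.indicator fun _ => (1 : ℝ)) P := integrable_indicator_one hA
  -- The intersections B ∩ C form a π-system generating the join; `huniv` supplies the total mass
  -- needed for complements.
  induction s, hs using MeasurableSpace.induction_on_inter
    (sup_eq_generateFrom_inter m₁ m₂) (isPiSystem_inter m₁ m₂) with
  | empty => simp
  | basic t ht =>
    obtain ⟨B, C, hB, hC, rfl⟩ := ht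
    rw [h B C hB hC, setIntegral_indicator_one hA]
  | compl t ht ih =>
    have h1 := integral_add_compl (hm t ht) hgi
    have h2 := integral_add_compl (hm t ht) hAi
    linarith
  | iUnion f hd hf ih =>
    rw [integral_iUnion (fun i => hm _ (hf i)) hd hgi.integrableOn,
      integral_iUnion (fun i => hm _ (hf i)) hd hAi.integrableOn]
    exact tsum_congr ih

lemma condProb_condProb_of_le (h : m' ≤ m) (hm : m ≤ mΩ) (A : Set Ω) :
    P[P⟦A | m⟧ | m'] =ᵐ[P] P⟦A | m'⟧ :=
  condExp_condExp_of_le h hm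

lemma condProb_inter (hm : m ≤ mΩ) {A B : Set Ω} (hA : MeasurableSet A)
    (hB : MeasurableSet[m] B) :
    P⟦A ∩ B | m⟧ =ᵐ[P] P⟦A | m⟧ * B.indicator fun _ => (1 : ℝ) := by
  have hf : (A ∩ B).indicator (fun _ => (1 : ℝ)) =
      (A.indicator fun _ => (1 : ℝ)) * B.indicator fun _ => (1 : ℝ) := by
    ext ω
    by_cases h : ω ∈ A <;> by_cases h' : ω ∈ B <;> simp [h, h']
  rw [hf]
  refine condExp_mul_of_stronglyMeasurable_right (stronglyMeasurable_const.indicator hB) ?_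
    (integrable_indicator_one hA)
  rw [← hf]
  exact integrable_indicator_one (hA.inter (hm _ hB))

/-- Conditional independence of `m₁` and `m₂` given `m'`: to predict `m₁`, nothing is gained by
adding `m₂` to `m'`. -/
lemma condIndepGiven_iff (h₁ : m₁ ≤ mΩ) (h₂ : m₂ ≤ mΩ)
    (h' : m' ≤ mΩ) :
    CondIndepGiven P m₁ m₂ m' ↔
      ∀ A, MeasurableSet[m₁] A → P⟦A | m₂ ⊔ m'⟧ =ᵐ[P] P⟦A | m'⟧ := by
  have hs : m₂ ⊔ m' ≤ mΩ := sup_le h₂ h'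
  -- Forwards, `P⟦A | m'⟧` is tested on the sets B ∩ C, where the factor 1_B is moved through the
  -- conditional expectation given `m'`. Backwards, one conditions first on `m₂ ⊔ m'`, where 1_B
  -- factors out, and then on `m'`.
  refine ⟨fun h A hA => ?_, fun h A B hA hB => ?_⟩
  · refine (ae_eq_condProb_sup h₂ h' (h₁ _ hA)
      (stronglyMeasurable_condExp.mono le_sup_right) integrable_condExp
      fun B C hB hC => ?_).symm
    have hAi : Integrable (P⟦A | m'⟧) P := integrable_condExp
    have hBm := h₂ _ hB
    have hBi := integrable_indicator_one (P := P) hBm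
    have hABi := integrable_mul_indicator_one hAi hBm
    have e1 : P[P⟦A | m'⟧ * B.indicator (fun _ => (1 : ℝ)) | m'] =ᵐ[P] P⟦A ∩ B | m'⟧ :=
      (condExp_mul_of_stronglyMeasurable_left stronglyMeasurable_condExp hABi hBi).trans
        (h A B hA hB).symm
    rw [← setIntegral_mul_indicator_one hBm, ← setIntegral_condExp h' hABi hC,
      setIntegral_congr_ae (h' _ hC) (e1.mono fun _ hω _ => hω),
      setIntegral_condExp h' (integrable_indicator_one ((h₁ _ hA).inter hBm)) hC,
      setIntegral_indicator_one ((h₁ _ hA).inter hBm)]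
    congr 1
    ext ω
    simp only [Set.mem_inter_iff]
    tauto
  · have hAi : Integrable (P⟦A | m'⟧) P := integrable_condExp
    have hBm := h₂ _ hB
    have hBi := integrable_indicator_one (P := P) hBm
    have hABi := integrable_mul_indicator_one hAi hBm
    have e1 : P⟦A ∩ B | m₂ ⊔ m'⟧ =ᵐ[P] P⟦A | m'⟧ * B.indicator fun _ => (1 : ℝ) :=
      (condProb_inter hs (h₁ _ hA) (le_sup_left (a := m₂) (b := m') B hB)).trans
        ((h A hA).mul (ae_eq_refl _))
    refine (condProb_condProb_of_le (le_sup_right (a := m₂)) hs _).symm.trans ?_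
    refine (condExp_congr_ae e1).trans ?_
    exact condExp_mul_of_stronglyMeasurable_left stronglyMeasurable_condExp hABi hBi

/-- Both `P⟦A | m₂ ⊔ m'⟧` and `P⟦A | n ⊔ m'⟧` equal `P⟦A | m'⟧`. Weak union, contraction and
symmetry are the rules by which independences are combined below, without returning to conditional
expectations. -/
lemma CondIndepGiven.weakUnion (h : CondIndepGiven P m₁ m₂ m')
    (h₁ : m₁ ≤ mΩ) (h₂ : m₂ ≤ mΩ) (h' : m' ≤ mΩ) (hn : n ≤ m₂) :
    CondIndepGiven P m₁ m₂ (n ⊔ m') := by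
  have hn' := hn.trans h₂
  rw [condIndepGiven_iff h₁ h₂ (sup_le hn' h')]
  intro A hA
  rw [← sup_assoc, sup_eq_left.2 hn]
  exact ((condIndepGiven_iff h₁ h₂ h').1 h A hA).trans
    ((condIndepGiven_iff h₁ hn' h').1 (h.mono le_rfl hn) A hA).symm

lemma CondIndepGiven.contraction
    (h : CondIndepGiven P m₁ m₂ m') (h3 : CondIndepGiven P m₁ m₃ (m₂ ⊔ m'))
    (h₁ : m₁ ≤ mΩ) (h₂ : m₂ ≤ mΩ) (h₃ : m₃ ≤ mΩ) (h' : m' ≤ mΩ) :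
    CondIndepGiven P m₁ (m₃ ⊔ m₂) m' := by
  rw [condIndepGiven_iff h₁ (sup_le h₃ h₂) h']
  intro A hA
  rw [sup_assoc]
  exact ((condIndepGiven_iff h₁ h₃ (sup_le h₂ h')).1 h3 A hA).trans
    ((condIndepGiven_iff h₁ h₂ h').1 h A hA)

/-- The conditioning may be added to the right-hand side. -/
lemma CondIndepGiven.sup_right (h : CondIndepGiven P m₁ m₂ m')
    (h₁ : m₁ ≤ mΩ) (h₂ : m₂ ≤ mΩ) (h' : m' ≤ mΩ) : CondIndepGiven P m₁ (m₂ ⊔ m') m' := by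
  rw [condIndepGiven_iff h₁ (sup_le h₂ h') h']
  intro A hA
  rw [sup_assoc, sup_idem]
  exact (condIndepGiven_iff h₁ h₂ h').1 h A hA

lemma condIndepGiven_bot (h₁ : m₁ ≤ mΩ) (h' : m' ≤ mΩ) :
    CondIndepGiven P m₁ ⊥ m' := by
  rw [condIndepGiven_iff h₁ bot_le h', bot_sup_eq]
  exact fun _ _ => ae_eq_refl _

end CondIndepGiven

/-! ### Conditional independence of parts of a process -/

section sigmaOn

variable {Ω T S : Type*} [MeasurableSpace S]

lemma sigmaOn_union (X : T → Ω → S) (A B : Set T) :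
    sigmaOn X (A ∪ B) = sigmaOn X A ⊔ sigmaOn X B := iSup_union

lemma sigmaOn_empty (X : T → Ω → S) : sigmaOn X ∅ = ⊥ := by simp

lemma sigmaOn_mono (X : T → Ω → S) {A B : Set T} (h : A ⊆ B) : sigmaOn X A ≤ sigmaOn X B :=
  biSup_mono h

lemma sigmaOn_comp_right {T' : Type*} (X : T → Ω → S) (f : T' → T) (A : Set T') :
    sigmaOn (fun t => X (f t)) A = sigmaOn X (f '' A) := by
  rw [sigmaOn, sigmaOn, iSup_image]

lemma sigmaOn_comp_left {Ω' : Type*} (X : T → Ω → S) (f : Ω' → Ω) (A : Set T) :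
    sigmaOn (fun t ω => X t (f ω)) A = (sigmaOn X A).comap f := by
  have h (t : T) : MeasurableSpace.comap (fun ω => X t (f ω)) inferInstance =
      (MeasurableSpace.comap (X t) inferInstance).comap f :=
    MeasurableSpace.comap_comp.symm
  rw [sigmaOn, sigmaOn, MeasurableSpace.comap_iSup]
  refine iSup_congr fun t => ?_
  rw [MeasurableSpace.comap_iSup]
  exact iSup_congr fun _ => h t

lemma sigmaOn_eq_comap (X : T → Ω → S) (A : Set T) :
    sigmaOn X A = MeasurableSpace.comap (fun ω (t : A) => X t ω) inferInstance := by
  have h (t : A) : (MeasurableSpace.comap (fun x : A → S => x t) inferInstance).comap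
      (fun ω (t : A) => X t ω) = MeasurableSpace.comap (X t) inferInstance :=
    MeasurableSpace.comap_comp
  unfold MeasurableSpace.pi
  rw [MeasurableSpace.comap_iSup, sigmaOn, iSup_subtype']
  exact iSup_congr fun t => (h t).symm

lemma sigmaOn_range {T' : Type*} (X : T → Ω → S) (f : T' → T) :
    sigmaOn X (Set.range f) = MeasurableSpace.comap (fun ω t => X (f t) ω) inferInstance := by
  have h (t : T') : (MeasurableSpace.comap (fun x : T' → S => x t) inferInstance).comap
      (fun ω t => X (f t) ω) = MeasurableSpace.comap (X (f t)) inferInstance :=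
    MeasurableSpace.comap_comp
  unfold MeasurableSpace.pi
  rw [MeasurableSpace.comap_iSup, sigmaOn, iSup_range]
  exact iSup_congr fun t => (h t).symm

lemma sigmaOn_le [mΩ : MeasurableSpace Ω] {X : T → Ω → S} (hX : ∀ t, Measurable (X t))
    (A : Set T) : sigmaOn X A ≤ mΩ :=
  iSup₂_le fun t _ => (hX t).comap_le

end sigmaOn

/-- `X` on `A` and `X` on `B` are conditionally independent given `X` on `C`. -/
def CondIndepOn {Ω T S : Type*} [MeasurableSpace S] [MeasurableSpace Ω] (P : Measure Ω)
    (X : T → Ω → S) (A B C : Set T) : Prop :=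
  CondIndepGiven P (sigmaOn X A) (sigmaOn X B) (sigmaOn X C)

namespace CondIndepOn

variable {Ω T S : Type*} [MeasurableSpace S] [MeasurableSpace Ω] {P : Measure Ω}
  {X : T → Ω → S} {A B C D : Set T}

lemma symm (h : CondIndepOn P X A B C) : CondIndepOn P X B A C := CondIndepGiven.symm h

lemma mono (h : CondIndepOn P X A B C) {A' B' : Set T} (hA : A' ⊆ A) (hB : B' ⊆ B) :
    CondIndepOn P X A' B' C :=
  CondIndepGiven.mono h (sigmaOn_mono X hA) (sigmaOn_mono X hB)

variable [IsProbabilityMeasure P]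

lemma weakUnion (hX : ∀ t, Measurable (X t)) (h : CondIndepOn P X A B C) (hD : D ⊆ B) :
    CondIndepOn P X A B (D ∪ C) := by
  unfold CondIndepOn
  rw [sigmaOn_union]
  exact CondIndepGiven.weakUnion h (sigmaOn_le hX A) (sigmaOn_le hX B) (sigmaOn_le hX C)
    (sigmaOn_mono X hD)

lemma contraction (hX : ∀ t, Measurable (X t)) (h : CondIndepOn P X A B C)
    (h' : CondIndepOn P X A D (B ∪ C)) : CondIndepOn P X A (D ∪ B) C := by
  unfold CondIndepOn at *
  rw [sigmaOn_union] at *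
  exact CondIndepGiven.contraction h h' (sigmaOn_le hX A) (sigmaOn_le hX B) (sigmaOn_le hX D)
    (sigmaOn_le hX C)

lemma union_right (hX : ∀ t, Measurable (X t)) (h : CondIndepOn P X A B C) :
    CondIndepOn P X A (B ∪ C) C := by
  unfold CondIndepOn at *
  rw [sigmaOn_union] at *
  exact CondIndepGiven.sup_right h (sigmaOn_le hX A) (sigmaOn_le hX B) (sigmaOn_le hX C)

lemma union_left (hX : ∀ t, Measurable (X t)) (h : CondIndepOn P X A B C) :
    CondIndepOn P X (A ∪ C) B C := (h.symm.union_right hX).symm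

lemma empty_right (hX : ∀ t, Measurable (X t)) : CondIndepOn P X A ∅ C := by
  unfold CondIndepOn
  rw [sigmaOn_empty]
  exact condIndepGiven_bot (sigmaOn_le hX A) (sigmaOn_le hX C)

lemma empty_left (hX : ∀ t, Measurable (X t)) : CondIndepOn P X ∅ B C := (empty_right hX).symm

/-- Two processes, on `A₁ ∪ A₂ ∪ A₀` and on `B₁ ∪ B₂ ∪ B₀`, which are conditionally independent
given the values on an interface `D`. A splitting of each of them which does not split the interface
is a splitting of the joint process. -/
lemma glue (hX : ∀ t, Measurable (X t)) {A₁ A₂ A₀ B₁ B₂ B₀ : Set T}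
    (hAB : CondIndepOn P X (A₁ ∪ A₂ ∪ A₀) (B₁ ∪ B₂ ∪ B₀) D)
    (hDA : D ⊆ A₁ ∪ A₀) (hDB : D ⊆ B₁ ∪ B₀)
    (hA : CondIndepOn P X A₁ A₂ A₀) (hB : CondIndepOn P X B₁ B₂ B₀) :
    CondIndepOn P X (A₁ ∪ B₁) (A₂ ∪ B₂) (A₀ ∪ B₀) := by
  have sub {s t : Set T} (h : ∀ x, x ∈ s → x ∈ t) : s ⊆ t := h
  have hABr := hAB.union_right hX
  have hABl := hAB.symm.union_right hX
  -- The interface is contained in A₁ ∪ A₀, so conditioning on A₁ ∪ A₀ includes conditioning on D.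
  -- This is where it matters that D is not split.
  have a1 : CondIndepOn P X A₂ (B₁ ∪ B₂ ∪ B₀) (A₁ ∪ A₀) := by
    refine ((hABl.weakUnion hX (D := A₁ ∪ A₀) ?_).symm.mono ?_ ?_ : CondIndepOn P X A₂
      (B₁ ∪ B₂ ∪ B₀) (A₁ ∪ A₀ ∪ D)) |> fun h => by rwa [Set.union_eq_left.2 hDA] at h
    all_goals (apply sub; intro x; simp only [Set.mem_union]; tauto)
  have a2 : CondIndepOn P X A₂ (B₁ ∪ B₂ ∪ B₀ ∪ A₁) A₀ := hA.symm.contraction hX a1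
  have a3 : CondIndepOn P X A₂ (A₁ ∪ B₁) (A₀ ∪ B₀) := by
    have := a2.weakUnion hX (D := B₀) (by apply sub; intro x; simp only [Set.mem_union]; tauto)
    rw [Set.union_comm A₀]
    refine this.mono subset_rfl ?_
    apply sub; intro x; simp only [Set.mem_union]; tauto
  have b1 : CondIndepOn P X B₂ (A₁ ∪ A₂ ∪ A₀) (B₁ ∪ B₀) := by
    refine ((hABr.weakUnion hX (D := B₁ ∪ B₀) ?_).symm.mono ?_ ?_ : CondIndepOn P X B₂
      (A₁ ∪ A₂ ∪ A₀) (B₁ ∪ B₀ ∪ D)) |> fun h => by rwa [Set.union_eq_left.2 hDB] at h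
    all_goals (apply sub; intro x; simp only [Set.mem_union]; tauto)
  have b2 : CondIndepOn P X B₂ (A₁ ∪ A₂ ∪ A₀ ∪ B₁) B₀ := hB.symm.contraction hX b1
  have b3 : CondIndepOn P X B₂ (A₁ ∪ B₁) (A₂ ∪ (A₀ ∪ B₀)) := by
    have := b2.weakUnion hX (D := A₂ ∪ A₀)
      (by apply sub; intro x; simp only [Set.mem_union]; tauto)
    rw [← Set.union_assoc]
    refine this.mono subset_rfl ?_
    apply sub; intro x; simp only [Set.mem_union]; tauto
  -- A₂ and B₂ are split off from A₁ ∪ B₁ one after the other: A₂ given A₀ ∪ B₀, then B₂ given A₂ as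
  -- well.
  have c := a3.symm.contraction hX b3.symm
  rwa [Set.union_comm B₂] at c

end CondIndepOn

/-- A process with the Markov property, indexed by a linear order. If each point of `U₁` is
separated from each point of `U₂` by a point of the finite set `W`, then the process on `U₁` and the
process on `U₂` are conditionally independent given the process on `W`. -/
lemma condIndepOn_of_markov {Ω T S : Type*} [LinearOrder T] [MeasurableSpace S]
    [MeasurableSpace Ω] {P : Measure Ω} [IsProbabilityMeasure P] {X : T → Ω → S}
    (hX : ∀ t, Measurable (X t))
    (hM : ∀ t, CondIndepOn P X (Set.Iic t) (Set.Ici t) {t}) (W : Finset T) :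
    ∀ U₁ U₂ : Set T, (∀ a ∈ U₁, ∀ b ∈ U₂, ∃ w ∈ W, w ∈ Set.uIcc a b) →
      CondIndepOn P X U₁ U₂ W := by
  induction W using Finset.induction_on_max with
  | empty =>
    intro U₁ U₂ h
    rcases U₁.eq_empty_or_nonempty with rfl | ⟨a, ha⟩
    · exact CondIndepOn.empty_left hX
    rcases U₂.eq_empty_or_nonempty with rfl | ⟨b, hb⟩
    · exact CondIndepOn.empty_right hX
    obtain ⟨w, hw, -⟩ := h a ha b hb
    simp at hw
  | insert w W hW ih =>
    -- the case where `U₂` has no point beyond `w`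
    have key : ∀ U₁ U₂ : Set T,
        (∀ a ∈ U₁, ∀ b ∈ U₂, ∃ w' ∈ insert w W, w' ∈ Set.uIcc a b) → (∀ b ∈ U₂, b ≤ w) →
        CondIndepOn P X U₁ U₂ (insert w W : Finset T) := by
      intro U₁ U₂ h hU₂
      -- To the left of w, the smaller set W already separates. To condition on w too, w is put into
      -- one of the two sets and then moved by weak union, so it has to be separated by W from the
      -- other set.
      have hL : CondIndepOn P X (U₁ ∩ Set.Iio w) (U₂ ∩ Set.Iio w) (insert w W : Finset T) := by
        by_cases h1 : ∀ b ∈ U₂ ∩ Set.Iio w, ∃ w' ∈ W, w' ∈ Set.uIcc w b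
        · have := ih (U₁ ∩ Set.Iio w ∪ {w}) (U₂ ∩ Set.Iio w) (by
            rintro a (⟨ha, haw⟩ | rfl) b hb
            · obtain ⟨w', hw', hab⟩ := h a ha b hb.1
              rcases Finset.mem_insert.1 hw' with rfl | hw'
              · rcases Set.mem_uIcc.1 hab with h | h
                · exact absurd (h.2.trans_lt hb.2) (lt_irrefl _)
                · exact absurd (h.2.trans_lt haw) (lt_irrefl _)
              · exact ⟨w', hw', hab⟩
            · exact h1 b hb)
          have := this.symm.weakUnion hX (D := {w}) Set.subset_union_right
          rw [Finset.coe_insert]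
          exact (this.mono subset_rfl Set.subset_union_left).symm
        -- Some b in U₂ to the left of w has no point of W between itself and w. A point of W
        -- between a and b must then lie below b, hence between a and w; so w may join U₂.
        · push Not at h1
          obtain ⟨b, hb, hwb⟩ := h1
          have := ih (U₁ ∩ Set.Iio w) (U₂ ∩ Set.Iio w ∪ {w}) (by
            rintro a ⟨ha, haw⟩ c (hc | rfl)
            · obtain ⟨w', hw', hab⟩ := h a ha c hc.1
              rcases Finset.mem_insert.1 hw' with rfl | hw'
              · rcases Set.mem_uIcc.1 hab with h | h
                · exact absurd (h.2.trans_lt hc.2) (lt_irrefl _)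
                · exact absurd (h.2.trans_lt haw) (lt_irrefl _)
              · exact ⟨w', hw', hab⟩
            · obtain ⟨w', hw', hab⟩ := h a ha b hb.1
              rcases Finset.mem_insert.1 hw' with rfl | hw'
              · rcases Set.mem_uIcc.1 hab with h | h
                · exact absurd (h.2.trans_lt hb.2) (lt_irrefl _)
                · exact absurd (h.2.trans_lt haw) (lt_irrefl _)
              · have hw'c := hW _ hw'
                have hn := hwb w' hw'
                rw [Set.uIcc_of_ge (le_of_lt hb.2), Set.mem_Icc] at hn
                refine ⟨w', hw', ?_⟩
                rw [Set.uIcc_of_le (le_of_lt haw)]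
                rcases Set.mem_uIcc.1 hab with h | h
                · exact ⟨h.1, hw'c.le⟩
                · exact absurd ⟨h.1, hw'c.le⟩ hn)
          have := this.weakUnion hX (D := {w}) Set.subset_union_right
          rw [Finset.coe_insert]
          exact this.mono subset_rfl Set.subset_union_left
      -- The Markov property at w itself, with the relevant part of the past moved into the
      -- conditioning.
      have hR : CondIndepOn P X (U₂ ∩ Set.Iio w) (U₁ ∩ Set.Ici w)
          (U₁ ∩ Set.Iio w ∪ (insert w W : Finset T)) := by
        have := (hM w).symm.weakUnion hX (D := U₁ ∩ Set.Iio w ∪ W) (by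
          rintro x (hx | hx)
          · exact le_of_lt hx.2
          · exact (hW x hx).le)
        rw [Finset.coe_insert, ← Set.union_singleton, ← Set.union_assoc]
        exact (this.mono Set.inter_subset_right fun x hx => le_of_lt hx.2).symm
      have := (hL.symm.contraction hX hR).union_left hX
      refine (this.mono ?_ ?_).symm
      · intro b hb
        rcases (hU₂ b hb).lt_or_eq with h | rfl
        · exact Or.inl ⟨hb, h⟩
        · exact Or.inr (by simp)
      · intro a ha
        rcases lt_or_ge a w with h | h
        · exact Or.inr ⟨ha, h⟩
        · exact Or.inl ⟨ha, h⟩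
    intro U₁ U₂ h
    by_cases h2 : ∀ b ∈ U₂, b ≤ w
    · exact key U₁ U₂ h h2
    · push Not at h2
      obtain ⟨b, hb, hwb⟩ := h2
      -- U₁ and U₂ cannot both have points beyond the maximum w, since nothing in `insert w W` would
      -- separate them; so the roles may be exchanged.
      refine (key U₂ U₁ (fun b hb a ha => by
        obtain ⟨w', hw', h'⟩ := h a ha b hb
        exact ⟨w', hw', Set.uIcc_comm a b ▸ h'⟩) fun a ha => ?_).symm
      by_contra hwa
      obtain ⟨w', hw', h'⟩ := h a ha b hb
      have hw'w : w' ≤ w := by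
        rcases Finset.mem_insert.1 hw' with rfl | hw'
        · exact le_rfl
        · exact (hW _ hw').le
      rcases Set.mem_uIcc.1 h' with h | h
      · exact hwa (h.1.trans hw'w)
      · exact absurd (hwb.trans_le (h.1.trans hw'w)) (lt_irrefl _)

/-! ### Images, and conditional laws -/

section Law

variable {Ω Ω' : Type*} {m₁ m₂ m : MeasurableSpace Ω'} {mΩ : MeasurableSpace Ω}
  {mΩ' : MeasurableSpace Ω'} {P : Measure Ω} [IsProbabilityMeasure P]

/-- Change of variables on each set f⁻¹(C). This carries conditional independence from the law of a
process back to the process. -/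
lemma condProb_map_comp {f : Ω → Ω'} (hf : Measurable f) (hm : m ≤ mΩ') {A : Set Ω'}
    (hA : MeasurableSet A) :
    (P.map f)⟦A | m⟧ ∘ f =ᵐ[P] P⟦f ⁻¹' A | m.comap f⟧ := by
  have := Measure.isProbabilityMeasure_map (μ := P) hf.aemeasurable
  have hi : Integrable ((P.map f)⟦A | m⟧) (P.map f) := integrable_condExp
  refine ae_eq_condProb ((MeasurableSpace.comap_mono hm).trans hf.comap_le) (hf hA)
    (stronglyMeasurable_condExp.comp_measurable (comap_measurable f))
    (hi.comp_measurable hf) ?_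
  rintro _ ⟨C, hC, rfl⟩
  have := setIntegral_map (hm _ hC) hi.aestronglyMeasurable hf.aemeasurable
  rw [Function.comp_def, ← this, setIntegral_condExp hm (integrable_indicator_one hA) hC,
    setIntegral_indicator_one hA, map_measureReal_apply hf ((hm _ hC).inter hA)]
  rfl

lemma CondIndepGiven.comap {f : Ω → Ω'} (hf : Measurable f) (h₁ : m₁ ≤ mΩ') (h₂ : m₂ ≤ mΩ')
    (hm : m ≤ mΩ') (h : CondIndepGiven (P.map f) m₁ m₂ m) :
    CondIndepGiven P (m₁.comap f) (m₂.comap f) (m.comap f) := by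
  rintro _ _ ⟨A, hA, rfl⟩ ⟨B, hB, rfl⟩
  have h0 := ae_of_ae_map hf.aemeasurable (h A B hA hB)
  have hAB := condProb_map_comp (P := P) hf hm ((h₁ _ hA).inter (h₂ _ hB))
  filter_upwards [h0, hAB, condProb_map_comp (P := P) hf hm (h₁ _ hA),
    condProb_map_comp (P := P) hf hm (h₂ _ hB)] with ω h0 h1 h2 h3
  rw [Set.preimage_inter] at h1
  rw [Pi.mul_apply, ← h1, ← h2, ← h3]
  exact h0

/-- Conditional independence of parts of a process depends only on the law of the process. -/
lemma condIndepOn_of_map {T S : Type*} [MeasurableSpace S] {X : T → Ω → S}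
    (hX : ∀ t, Measurable (X t)) {A B C : Set T}
    (h : CondIndepOn (P.map fun ω t => X t ω) (fun t (y : T → S) => y t) A B C) :
    CondIndepOn P X A B C := by
  have hY (t : T) : Measurable fun y : T → S => y t := measurable_pi_apply t
  have := CondIndepGiven.comap (measurable_pi_lambda _ hX) (sigmaOn_le hY A)
    (sigmaOn_le hY B) (sigmaOn_le hY C) h
  rw [← sigmaOn_comp_left, ← sigmaOn_comp_left, ← sigmaOn_comp_left] at this
  exact this

variable {α β γ : Type*} {mα : MeasurableSpace α} {mβ : MeasurableSpace β}
  {mγ : MeasurableSpace γ} {Z : Ω → α} {Y : Ω → β}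

lemma compProd_map_left {μ : Measure γ} [IsProbabilityMeasure μ] {κ : Kernel α β}
    [IsMarkovKernel κ] {h : γ → α} (hh : Measurable h) :
    (μ.map h) ⊗ₘ κ = (μ ⊗ₘ κ.comap h hh).map (Prod.map h id) := by
  have := Measure.isProbabilityMeasure_map (μ := μ) hh.aemeasurable
  refine Measure.ext_prod fun {s t} hs ht => ?_
  rw [Measure.compProd_apply_prod hs ht, Measure.map_apply (hh.prodMap measurable_id) (hs.prod ht),
    show Prod.map h id ⁻¹' s ×ˢ t = (h ⁻¹' s) ×ˢ t from rfl,
    Measure.compProd_apply_prod (hh hs) ht, setLIntegral_map hs (κ.measurable_coe ht) hh]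
  rfl

/-- A kernel which is a conditional law of `Y` given `Z` gives the conditional probabilities. -/
lemma condProb_of_map_eq_compProd (hZ : Measurable Z) (hY : Measurable Y) {κ : Kernel α β}
    [IsMarkovKernel κ] (h : P.map (fun ω => (Z ω, Y ω)) = P.map Z ⊗ₘ κ) {B : Set β}
    (hB : MeasurableSet B) :
    (fun ω => (κ (Z ω)).real B) =ᵐ[P] P⟦Y ⁻¹' B | mα.comap Z⟧ := by
  have := Measure.isProbabilityMeasure_map (μ := P) hZ.aemeasurable
  have hκ : Measurable fun z => (κ z).real B := (κ.measurable_coe hB).ennreal_toReal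
  refine ae_eq_condProb hZ.comap_le (hY hB)
    (hκ.comp (comap_measurable Z)).stronglyMeasurable ?_ ?_
  · exact Integrable.of_bound (hκ.comp hZ).aestronglyMeasurable 1
      (ae_of_all _ fun ω => by simp [abs_of_nonneg, measureReal_le_one])
  · rintro _ ⟨D, hD, rfl⟩
    have e : P (Z ⁻¹' D ∩ Y ⁻¹' B) = ∫⁻ z in D, κ z B ∂(P.map Z) := by
      rw [← Measure.compProd_apply_prod hD hB, ← h,
        Measure.map_apply (hZ.prodMk hY) (hD.prod hB)]
      rfl
    rw [Measure.real, e, setLIntegral_map hD (κ.measurable_coe hB) hZ]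
    exact integral_toReal ((κ.measurable_coe hB).comp hZ).aemeasurable
      (ae_of_all _ fun ω => measure_lt_top _ _)

/-- If the conditional law of `Y` given `Z` is a function of `g Z`, then `Y` and `Z` are
conditionally independent given `g Z`. -/
lemma condIndepGiven_of_map_eq_compProd (hZ : Measurable Z) (hY : Measurable Y) {g : α → γ}
    (hg : Measurable g) {κ : Kernel γ β} [IsMarkovKernel κ]
    (h : P.map (fun ω => (Z ω, Y ω)) = P.map Z ⊗ₘ κ.comap g hg) :
    CondIndepGiven P (mβ.comap Y) (mα.comap Z) (mγ.comap fun ω => g (Z ω)) := by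
  have hgZ : Measurable fun ω => g (Z ω) := hg.comp hZ
  have hle : mγ.comap (fun ω => g (Z ω)) ≤ mα.comap Z := by
    have : mγ.comap (fun ω => g (Z ω)) = (mγ.comap g).comap Z := MeasurableSpace.comap_comp.symm
    rw [this]
    exact MeasurableSpace.comap_mono hg.comap_le
  rw [condIndepGiven_iff hY.comap_le hZ.comap_le hgZ.comap_le]
  rintro _ ⟨B, hB, rfl⟩
  rw [sup_eq_left.2 hle]
  have e := condProb_of_map_eq_compProd hZ hY h hB
  refine e.symm.trans ?_
  -- The version of the conditional probability given Z is a function of g Z, so conditioning it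
  -- further on g Z leaves it unchanged.
  refine Filter.EventuallyEq.trans ?_ (condProb_condProb_of_le hle hZ.comap_le (Y ⁻¹' B))
  refine Filter.EventuallyEq.trans ?_ (condExp_congr_ae e)
  have hκ : Measurable fun z => (κ z).real B := (κ.measurable_coe hB).ennreal_toReal
  have hm : StronglyMeasurable[mγ.comap fun ω => g (Z ω)] fun ω => (κ (g (Z ω))).real B :=
    (hκ.comp (comap_measurable _)).stronglyMeasurable
  have := condExp_of_stronglyMeasurable (μ := P) hgZ.comap_le hm
    (Integrable.of_bound (hκ.comp hgZ).aestronglyMeasurable 1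
      (ae_of_all _ fun ω => by simp [abs_of_nonneg, measureReal_le_one]))
  exact (Filter.EventuallyEq.of_eq this).symm

/-- If `Y` and `Z` are conditionally independent given `g Z`, then a conditional law of `Y` given
`g Z` gives a conditional law of `Y` given `Z`. -/
lemma map_eq_compProd_of_condIndepGiven (hZ : Measurable Z) (hY : Measurable Y) {g : α → γ}
    (hg : Measurable g) {κ : Kernel γ β} [IsMarkovKernel κ]
    (h : P.map (fun ω => (g (Z ω), Y ω)) = P.map (fun ω => g (Z ω)) ⊗ₘ κ)
    (hci : CondIndepGiven P (mβ.comap Y) (mα.comap Z) (mγ.comap fun ω => g (Z ω))) :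
    P.map (fun ω => (Z ω, Y ω)) = P.map Z ⊗ₘ κ.comap g hg := by
  have hgZ : Measurable fun ω => g (Z ω) := hg.comp hZ
  have := Measure.isProbabilityMeasure_map (μ := P) hZ.aemeasurable
  have := Measure.isProbabilityMeasure_map (μ := P) (hZ.prodMk hY).aemeasurable
  have hle : mγ.comap (fun ω => g (Z ω)) ≤ mα.comap Z := by
    have : mγ.comap (fun ω => g (Z ω)) = (mγ.comap g).comap Z := MeasurableSpace.comap_comp.symm
    rw [this]
    exact MeasurableSpace.comap_mono hg.comap_le
  refine Measure.ext_prod fun {D B} hD hB => ?_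
  have e := condProb_of_map_eq_compProd hgZ hY h hB
  have e' := (condIndepGiven_iff hY.comap_le hZ.comap_le hgZ.comap_le).1 hci (Y ⁻¹' B)
    ⟨B, hB, rfl⟩
  rw [sup_eq_left.2 hle] at e'
  have hDm : MeasurableSet[mα.comap Z] (Z ⁻¹' D) := ⟨D, hD, rfl⟩
  have e2 : P.real (Z ⁻¹' D ∩ Y ⁻¹' B) = ∫ ω in Z ⁻¹' D, (κ (g (Z ω))).real B ∂P := by
    rw [← setIntegral_indicator_one (hY hB), ← setIntegral_condExp hZ.comap_le
      (integrable_indicator_one (hY hB)) hDm]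
    exact setIntegral_congr_ae (hZ hD) ((e'.trans e.symm).mono fun _ hω _ => hω)
  rw [Measure.compProd_apply_prod hD hB, Measure.map_apply (hZ.prodMk hY) (hD.prod hB),
    setLIntegral_map hD ((κ.comap g hg).measurable_coe hB) hZ]
  change P (Z ⁻¹' D ∩ Y ⁻¹' B) = ∫⁻ ω in Z ⁻¹' D, κ (g (Z ω)) B ∂P
  have hfin : ∫⁻ ω in Z ⁻¹' D, κ (g (Z ω)) B ∂P ≠ ⊤ := by
    refine ne_top_of_le_ne_top ENNReal.one_ne_top
      ((setLIntegral_mono' (hZ hD) fun ω _ => prob_le_one).trans ?_)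
    rw [setLIntegral_one]
    exact prob_le_one
  rw [← ENNReal.toReal_eq_toReal_iff' (measure_ne_top _ _) hfin]
  refine e2.trans ?_
  exact integral_toReal ((κ.measurable_coe hB).comp hgZ).aemeasurable
    (ae_of_all _ fun ω => measure_lt_top _ _)

end Law

namespace TLG

/-! ### Points and paths -/

section Paths

variable {G : TLG}

lemma edgePoint_of_le {e : G.E} {τ : unitInterval} (h : τ ≤ G.time (G.src e)) :
    G.edgePoint e τ = .vertex (G.src e) := dif_pos h

lemma edgePoint_of_ge {e : G.E} {τ : unitInterval} (h : G.time (G.tgt e) ≤ τ) :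
    G.edgePoint e τ = .vertex (G.tgt e) := by
  simp [edgePoint, not_le.2 ((G.time_lt e).trans_le h), h]

lemma edgePoint_of_mem_Ioo {e : G.E} {τ : unitInterval}
    (h : τ ∈ Set.Ioo (G.time (G.src e)) (G.time (G.tgt e))) :
    G.edgePoint e τ = .inner e ⟨τ, h⟩ := by
  simp [edgePoint, not_le.2 h.1, not_le.2 h.2]

lemma edgePoint_src (e : G.E) : G.edgePoint e (G.time (G.src e)) = .vertex (G.src e) :=
  edgePoint_of_le le_rfl

lemma edgePoint_tgt (e : G.E) : G.edgePoint e (G.time (G.tgt e)) = .vertex (G.tgt e) :=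
  edgePoint_of_ge le_rfl

/-- The time of a point. -/
def Point.time : G.Point → unitInterval
  | .vertex v => G.time v
  | .inner _ τ => τ

lemma time_edgePoint {e : G.E} {τ : unitInterval}
    (h : τ ∈ Set.Icc (G.time (G.src e)) (G.time (G.tgt e))) : (G.edgePoint e τ).time = τ := by
  unfold edgePoint
  split_ifs with h₁ h₂
  · exact le_antisymm h.1 h₁
  · exact le_antisymm h₂ h.2
  · rfl

lemma injOn_edgePoint (e : G.E) :
    Set.InjOn (G.edgePoint e) (Set.Icc (G.time (G.src e)) (G.time (G.tgt e))) := fun a ha b hb h => by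
  rw [← time_edgePoint ha, h, time_edgePoint hb]

lemma start_ne_final : G.start ≠ G.final := fun h => by
  have := G.time_start
  rw [h, G.time_final] at this
  exact one_ne_zero this

lemma eq_vertex_or_eq_edgePoint (p : G.Point) :
    (∃ v, p = .vertex v) ∨
      ∃ e, ∃ τ ∈ Set.Icc (G.time (G.src e)) (G.time (G.tgt e)), p = G.edgePoint e τ := by
  rcases p with v | ⟨e, τ, h⟩
  · exact Or.inl ⟨v, rfl⟩
  · exact Or.inr ⟨e, τ, ⟨h.1.le, h.2.le⟩, (edgePoint_of_mem_Ioo h).symm⟩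

lemma IsTimePath.time_le {u v : G.V} {l : List G.E} (h : G.IsTimePath u l v) :
    G.time u ≤ G.time v := by
  rcases h.eq_or_lt with rfl | h'
  · cases h
    exact le_rfl
  · exact h'.le

lemma IsTimePath.of_append {u v : G.V} {l₁ l₂ : List G.E} (h : G.IsTimePath u (l₁ ++ l₂) v) :
    ∃ w, G.IsTimePath u l₁ w ∧ G.IsTimePath w l₂ v := by
  induction l₁ generalizing u with
  | nil => exact ⟨u, rfl, h⟩
  | cons e l ih =>
    obtain ⟨w, h₁, h₂⟩ := ih h.2
    exact ⟨w, ⟨h.1, h₁⟩, h₂⟩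

/-- A path through the edge `e` consists of a path to `e`, the edge `e`, and a path from `e`. -/
lemma IsTimePath.split_at {u v : G.V} {l : List G.E} (h : G.IsTimePath u l v) {e : G.E}
    (he : e ∈ l) : ∃ l₁ l₂, l = l₁ ++ e :: l₂ ∧ G.IsTimePath u l₁ (G.src e) ∧
      G.IsTimePath (G.tgt e) l₂ v := by
  obtain ⟨l₁, l₂, rfl⟩ := List.append_of_mem he
  obtain ⟨w, h₁, h₂⟩ := h.of_append
  obtain ⟨rfl, h₂⟩ := h₂
  exact ⟨l₁, l₂, rfl, h₁, h₂⟩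

lemma IsTimePath.eq_or_time_lt {u v : G.V} {l : List G.E} (h : G.IsTimePath u l v) :
    u = v ∨ G.time u < G.time v := by
  rcases h.eq_or_lt with rfl | h'
  · exact Or.inl h
  · exact Or.inr h'

lemma IsTimePath.exists_src {u v : G.V} {l : List G.E} (h : G.IsTimePath u l v) (hl : l ≠ []) :
    ∃ e ∈ l, G.src e = u := by
  cases l with
  | nil => exact absurd rfl hl
  | cons e l => exact ⟨e, by simp, h.1⟩

lemma IsTimePath.exists_tgt {u v : G.V} {l : List G.E} (h : G.IsTimePath u l v) (hl : l ≠ []) :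
    ∃ e ∈ l, G.tgt e = v := by
  induction l generalizing u with
  | nil => exact absurd rfl hl
  | cons e l ih =>
    rcases eq_or_ne l [] with rfl | hl'
    · exact ⟨e, by simp, h.2⟩
    · obtain ⟨f, hf, hv⟩ := ih h.2 hl'
      exact ⟨f, List.mem_cons_of_mem _ hf, hv⟩

lemma IsTimePath.pointOn_eq {u v : G.V} {l : List G.E} (h : G.IsTimePath u l v) {e : G.E}
    (he : e ∈ l) {t : unitInterval} (ht : t ∈ Set.Icc (G.time (G.src e)) (G.time (G.tgt e))) :
    G.pointOn l t = G.edgePoint e t := by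
  induction l generalizing u with
  | nil => simp at he
  | cons f l ih =>
    rcases List.mem_cons.1 he with rfl | he
    · simp [pointOn, ht.2]
    · unfold pointOn
      split_ifs with hf
      · obtain ⟨l₁, l₂, rfl, h₁, h₂⟩ := h.2.split_at he
        have ht' : t = G.time (G.tgt f) := le_antisymm hf (h₁.time_le.trans ht.1)
        have hv : G.tgt f = G.src e := by
          rcases h₁.eq_or_time_lt with h | h
          · exact h
          · exact absurd (h.trans_le (ht.1.trans hf)) (lt_irrefl _)
        rw [ht', edgePoint_tgt, hv, edgePoint_src]
      · exact ih h.2 he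

lemma IsTimePath.exists_mem {u v : G.V} {l : List G.E} (h : G.IsTimePath u l v) (hl : l ≠ [])
    {t : unitInterval} (hu : G.time u ≤ t) (hv : t ≤ G.time v) :
    ∃ e ∈ l, t ∈ Set.Icc (G.time (G.src e)) (G.time (G.tgt e)) := by
  induction l generalizing u with
  | nil => exact absurd rfl hl
  | cons f l ih =>
    obtain ⟨rfl, h⟩ := h
    rcases le_or_gt t (G.time (G.tgt f)) with hf | hf
    · exact ⟨f, by simp, hu, hf⟩
    · have hl' : l ≠ [] := by
        rintro rfl
        cases h
        exact absurd (hf.trans_le hv) (lt_irrefl _)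
      obtain ⟨e, he, ht⟩ := ih h hl' hf.le
      exact ⟨e, List.mem_cons_of_mem _ he, ht⟩

lemma IsTimePath.pointOn_start {u v : G.V} {l : List G.E} (h : G.IsTimePath u l v)
    (hl : l ≠ []) : G.pointOn l (G.time u) = .vertex u := by
  obtain ⟨e, he, rfl⟩ := h.exists_src hl
  rw [h.pointOn_eq he ⟨le_rfl, (G.time_lt e).le⟩, edgePoint_src]

lemma IsTimePath.pointOn_final {u v : G.V} {l : List G.E} (h : G.IsTimePath u l v)
    (hl : l ≠ []) : G.pointOn l (G.time v) = .vertex v := by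
  obtain ⟨e, he, rfl⟩ := h.exists_tgt hl
  rw [h.pointOn_eq he ⟨(G.time_lt e).le, le_rfl⟩, edgePoint_tgt]

lemma FullPath.ne_nil (σ : G.FullPath) : σ.1 ≠ [] := fun h => by
  have := σ.2
  rw [h] at this
  exact start_ne_final this

lemma FullPath.point_eq (σ : G.FullPath) {e : G.E} (he : e ∈ σ.1) {t : unitInterval}
    (ht : t ∈ Set.Icc (G.time (G.src e)) (G.time (G.tgt e))) : σ.point t = G.edgePoint e t :=
  σ.2.pointOn_eq he ht

lemma FullPath.exists_mem (σ : G.FullPath) (t : unitInterval) :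
    ∃ e ∈ σ.1, t ∈ Set.Icc (G.time (G.src e)) (G.time (G.tgt e)) :=
  σ.2.exists_mem σ.ne_nil (by rw [G.time_start]; exact unitInterval.nonneg')
    (by rw [G.time_final]; exact unitInterval.le_one')

end Paths

/-! ### Points and paths along the steps of a tower -/

namespace EdgeStep

variable {H G : TLG} (s : EdgeStep H G)

lemma time_src (f : H.E) : G.time (G.src (s.onE (some f))) = H.time (H.src f) := by
  rw [s.src_old, s.time_eq]

lemma time_tgt (f : H.E) : G.time (G.tgt (s.onE (some f))) = H.time (H.tgt f) := by
  rw [s.tgt_old, s.time_eq]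

lemma time_src_new : G.time (G.src (s.onE none)) = H.time s.u := by
  rw [s.src_new, s.time_eq]

lemma time_tgt_new : G.time (G.tgt (s.onE none)) = H.time s.v := by
  rw [s.tgt_new, s.time_eq]

lemma time_u_lt : H.time s.u < H.time s.v := by
  rw [← s.time_src_new, ← s.time_tgt_new]
  exact G.time_lt _

lemma path_ne_nil : s.path ≠ [] := fun h => by
  have := s.isTimePath
  rw [h] at this
  exact absurd s.time_u_lt (by rw [show s.u = s.v from this]; exact lt_irrefl _)

lemma toPoint_edgePoint (f : H.E) (τ : unitInterval) :
    s.toPoint (H.edgePoint f τ) = G.edgePoint (s.onE (some f)) τ := by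
  by_cases h₁ : τ ≤ H.time (H.src f)
  · rw [edgePoint_of_le h₁, edgePoint_of_le (by rwa [s.time_src]), s.src_old]
    rfl
  by_cases h₂ : H.time (H.tgt f) ≤ τ
  · rw [edgePoint_of_ge h₂, edgePoint_of_ge (by rwa [s.time_tgt]), s.tgt_old]
    rfl
  · simp [edgePoint, h₁, h₂, toPoint]

lemma toFullPath_point (σ : H.FullPath) (t : unitInterval) :
    (s.toFullPath σ).point t = s.toPoint (σ.point t) := by
  obtain ⟨e, he, ht⟩ := σ.exists_mem t
  rw [σ.point_eq he ht, toPoint_edgePoint]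
  refine FullPath.point_eq _ (List.mem_map.2 ⟨e, he, rfl⟩) ?_
  rwa [s.time_src, s.time_tgt]

lemma exists_lift {u v : H.V} {l : List G.E} (h : G.IsTimePath (s.onV u) l (s.onV v))
    (hl : s.onE none ∉ l) :
    ∃ l', H.IsTimePath u l' v ∧ (l'.map fun f => s.onE (some f)) = l := by
  induction l generalizing u with
  | nil => exact ⟨[], s.onV.injective h, rfl⟩
  | cons e l ih =>
    obtain ⟨f, rfl⟩ := s.onE.surjective e
    rcases f with _ | f
    · simp at hl
    · obtain ⟨h₁, h₂⟩ := h
      rw [s.src_old] at h₁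
      rw [s.tgt_old] at h₂
      obtain ⟨l', hl', rfl⟩ := ih h₂ (fun h => hl (List.mem_cons_of_mem _ h))
      exact ⟨f :: l', ⟨s.onV.injective h₁, hl'⟩, rfl⟩

/-- A new edge does not change reachability. -/
lemma exists_isTimePath {u v : H.V} {l : List G.E} (h : G.IsTimePath (s.onV u) l (s.onV v)) :
    ∃ l', H.IsTimePath u l' v := by
  induction l generalizing u with
  | nil => exact ⟨[], s.onV.injective h⟩
  | cons e l ih =>
    obtain ⟨f, rfl⟩ := s.onE.surjective e
    obtain ⟨h₁, h₂⟩ := h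
    rcases f with _ | f
    · rw [s.src_new] at h₁
      rw [s.tgt_new] at h₂
      obtain ⟨l', hl'⟩ := ih h₂
      have := s.onV.injective h₁
      subst this
      exact ⟨_, s.isTimePath.append hl'⟩
    · rw [s.src_old] at h₁
      rw [s.tgt_old] at h₂
      obtain ⟨l', hl'⟩ := ih h₂
      exact ⟨f :: l', s.onV.injective h₁, hl'⟩

/-- A full path is a full path of the smaller graph, or passes through the new edge. In the latter
case it has a detour in the smaller graph. -/
lemma exists_detour (σ : G.FullPath) (hσ : s.onE none ∈ σ.1) :
    ∃ σ' : H.FullPath, σ'.point (H.time s.u) = .vertex s.u ∧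
      σ'.point (H.time s.v) = .vertex s.v ∧
      ∀ t, t ≤ H.time s.u ∨ H.time s.v ≤ t → σ.point t = s.toPoint (σ'.point t) := by
  obtain ⟨l₁, l₂, hl, h₁, h₂⟩ := σ.2.split_at hσ
  -- Time increases strictly along a path, so the new edge is passed only once; what precedes and
  -- follows it lifts to H, and `s.path` bridges the gap.
  have hn₁ : s.onE none ∉ l₁ := fun h => by
    obtain ⟨_, _, -, -, h'⟩ := h₁.split_at h
    exact absurd ((G.time_lt _).trans_le h'.time_le) (lt_irrefl _)
  have hn₂ : s.onE none ∉ l₂ := fun h => by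
    obtain ⟨_, _, -, h', -⟩ := h₂.split_at h
    exact absurd ((G.time_lt _).trans_le h'.time_le) (lt_irrefl _)
  rw [s.src_new, s.start_eq] at h₁
  rw [s.tgt_new, s.final_eq] at h₂
  obtain ⟨k₁, hk₁, rfl⟩ := s.exists_lift h₁ hn₁
  obtain ⟨k₂, hk₂, rfl⟩ := s.exists_lift h₂ hn₂
  let σ' : H.FullPath := ⟨k₁ ++ (s.path ++ k₂), hk₁.append (s.isTimePath.append hk₂)⟩
  have hmem : ∀ f ∈ σ'.1, s.onE (some f) ∈ (s.toFullPath σ').1 :=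
    fun f hf => List.mem_map.2 ⟨f, hf, rfl⟩
  have hu : σ'.point (H.time s.u) = .vertex s.u := by
    obtain ⟨f, hf, hu⟩ := s.isTimePath.exists_src s.path_ne_nil
    have hf' : f ∈ σ'.1 := by simp [σ', hf]
    rw [σ'.point_eq hf' ⟨(congrArg H.time hu).le, hu ▸ (H.time_lt f).le⟩, ← hu, edgePoint_src]
  have hv : σ'.point (H.time s.v) = .vertex s.v := by
    obtain ⟨f, hf, hv⟩ := s.isTimePath.exists_tgt s.path_ne_nil
    have hf' : f ∈ σ'.1 := by simp [σ', hf]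
    rw [σ'.point_eq hf' ⟨hv ▸ (H.time_lt f).le, (congrArg H.time hv).ge⟩, ← hv, edgePoint_tgt]
  refine ⟨σ', hu, hv, fun t ht => ?_⟩
  obtain ⟨e, he, hte⟩ := σ.exists_mem t
  rw [σ.point_eq he hte]
  by_cases hen : e = s.onE none
  · subst hen
    rcases ht with ht | ht
    · have : t = H.time s.u := le_antisymm ht (s.time_src_new ▸ hte.1)
      rw [this, hu, ← s.time_src_new, edgePoint_src, s.src_new]
      rfl
    · have : t = H.time s.v := le_antisymm (s.time_tgt_new ▸ hte.2) ht
      rw [this, hv, ← s.time_tgt_new, edgePoint_tgt, s.tgt_new]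
      rfl
  · rw [← s.toFullPath_point]
    refine (FullPath.point_eq _ ?_ hte).symm
    rw [hl] at he
    simp only [List.mem_append, List.mem_cons, List.mem_map, hen, false_or] at he
    rcases he with ⟨f, hf, rfl⟩ | ⟨f, hf, rfl⟩
    · exact hmem f (by simp [σ', hf])
    · exact hmem f (by simp [σ', hf])

lemma exists_toFullPath_eq (σ : G.FullPath) (hσ : s.onE none ∉ σ.1) :
    ∃ σ', s.toFullPath σ' = σ := by
  obtain ⟨k, h⟩ := σ
  have h0 := h
  rw [s.start_eq, s.final_eq] at h0
  obtain ⟨l, hl, h'⟩ := s.exists_lift h0 hσ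
  exact ⟨⟨l, hl⟩, Subtype.ext h'⟩

end EdgeStep

namespace VertexStep

variable {H G : TLG} (s : VertexStep H G)

lemma cover_split : s.cover s.split = [s.onE (Sum.inr false), s.onE (Sum.inr true)] :=
  dif_pos rfl

lemma cover_of_ne {f : H.E} (h : f ≠ s.split) : s.cover f = [s.onE (Sum.inl ⟨f, h⟩)] :=
  dif_neg h

lemma cover_ne_nil (f : H.E) : s.cover f ≠ [] := by
  unfold cover
  split_ifs <;> simp

lemma Icc_subset_of_mem_cover {f : H.E} {e : G.E} (he : e ∈ s.cover f) :
    Set.Icc (G.time (G.src e)) (G.time (G.tgt e)) ⊆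
      Set.Icc (H.time (H.src f)) (H.time (H.tgt f)) := by
  obtain ⟨_, _, -, h₁, h₂⟩ := (s.isTimePath_cover f).split_at he
  rw [← s.time_eq, ← s.time_eq]
  exact Set.Icc_subset_Icc h₁.time_le h₂.time_le

lemma toPoint_edgePoint {f : H.E} {e : G.E} (he : e ∈ s.cover f) {τ : unitInterval}
    (hτ : τ ∈ Set.Icc (G.time (G.src e)) (G.time (G.tgt e))) :
    s.toPoint (H.edgePoint f τ) = G.edgePoint e τ := by
  have hf := s.Icc_subset_of_mem_cover he hτ
  rw [← (s.isTimePath_cover f).pointOn_eq he hτ]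
  by_cases h₁ : τ ≤ H.time (H.src f)
  · have : τ = H.time (H.src f) := le_antisymm h₁ hf.1
    rw [this, edgePoint_src, ← s.time_eq, (s.isTimePath_cover f).pointOn_start (s.cover_ne_nil f)]
    rfl
  by_cases h₂ : H.time (H.tgt f) ≤ τ
  · have : τ = H.time (H.tgt f) := le_antisymm hf.2 h₂
    rw [this, edgePoint_tgt, ← s.time_eq, (s.isTimePath_cover f).pointOn_final (s.cover_ne_nil f)]
    rfl
  · simp [edgePoint, h₁, h₂, toPoint]

lemma exists_mem_cover {f : H.E} {τ : unitInterval}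
    (hτ : τ ∈ Set.Icc (H.time (H.src f)) (H.time (H.tgt f))) :
    ∃ e ∈ s.cover f, τ ∈ Set.Icc (G.time (G.src e)) (G.time (G.tgt e)) := by
  refine (s.isTimePath_cover f).exists_mem (s.cover_ne_nil f) ?_ ?_
  · rw [s.time_eq]; exact hτ.1
  · rw [s.time_eq]; exact hτ.2

lemma toFullPath_point (σ : H.FullPath) (t : unitInterval) :
    (s.toFullPath σ).point t = s.toPoint (σ.point t) := by
  obtain ⟨f, hf, ht⟩ := σ.exists_mem t
  obtain ⟨e, he, ht'⟩ := s.exists_mem_cover ht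
  rw [σ.point_eq hf ht, s.toPoint_edgePoint he ht']
  exact FullPath.point_eq _ (List.mem_flatMap.2 ⟨f, hf, he⟩) ht'

/-- A tail of the path may begin in the middle of the split edge. The second clause handles such
tails, which must start with the second half; the two clauses feed each other in the induction. -/
lemma exists_lift_aux {v : H.V} (l : List G.E) :
    (∀ u, G.IsTimePath (s.onV (some u)) l (s.onV (some v)) →
      ∃ l', H.IsTimePath u l' v ∧ l'.flatMap s.cover = l) ∧
    (G.IsTimePath (s.onV none) l (s.onV (some v)) →
      ∃ l', H.IsTimePath (H.tgt s.split) l' v ∧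
        s.onE (Sum.inr true) :: l'.flatMap s.cover = l) := by
  induction l with
  | nil =>
    exact ⟨fun u h => ⟨[], Option.some_injective _ (s.onV.injective h), rfl⟩,
      fun h => absurd (s.onV.injective h) (by simp)⟩
  | cons e l ih =>
    obtain ⟨f, rfl⟩ := s.onE.surjective e
    refine ⟨fun u ⟨h₁, h₂⟩ => ?_, fun ⟨h₁, h₂⟩ => ?_⟩ <;> rcases f with ⟨f, hf⟩ | _ | _
    · rw [s.src_old] at h₁
      rw [s.tgt_old] at h₂
      obtain ⟨l', hl', rfl⟩ := ih.1 _ h₂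
      exact ⟨f :: l', ⟨Option.some_injective _ (s.onV.injective h₁), hl'⟩,
        by simp [s.cover_of_ne hf]⟩
    · rw [s.src_fst] at h₁
      rw [s.tgt_fst] at h₂
      obtain ⟨l', hl', rfl⟩ := ih.2 h₂
      exact ⟨s.split :: l', ⟨Option.some_injective _ (s.onV.injective h₁), hl'⟩,
        by simp [s.cover_split]⟩
    · rw [s.src_snd] at h₁
      exact absurd (s.onV.injective h₁) (by simp)
    · rw [s.src_old] at h₁
      exact absurd (s.onV.injective h₁) (by simp)
    · rw [s.src_fst] at h₁
      exact absurd (s.onV.injective h₁) (by simp)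
    · rw [s.tgt_snd] at h₂
      obtain ⟨l', hl', rfl⟩ := ih.1 _ h₂
      exact ⟨l', hl', rfl⟩

lemma exists_lift {u v : H.V} {l : List G.E}
    (h : G.IsTimePath (s.onV (some u)) l (s.onV (some v))) :
    ∃ l', H.IsTimePath u l' v ∧ l'.flatMap s.cover = l :=
  (s.exists_lift_aux l).1 u h

lemma exists_toFullPath_eq (σ : G.FullPath) : ∃ σ', s.toFullPath σ' = σ := by
  obtain ⟨k, h⟩ := σ
  have h0 := h
  rw [s.start_eq, s.final_eq] at h0
  obtain ⟨l, hl, h'⟩ := s.exists_lift h0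
  exact ⟨⟨l, hl⟩, Subtype.ext h'⟩

end VertexStep

/-! ### Truly simple cells along the steps of a tower -/

section Cells

variable {G : TLG}

lemma IntervalAdj.symm {u v a b : G.V} (h : G.IntervalAdj u v a b) : G.IntervalAdj u v b a := by
  obtain ⟨ha, hb, e, he⟩ := h
  exact ⟨hb, ha, e, he.symm⟩

/-- A time-path between two inner vertices of the interval graph stays inside it. -/
lemma IsTimePath.reflTransGen_intervalAdj {u v a b : G.V} {l : List G.E}
    (h : G.IsTimePath a l b) (ha : a ∈ G.intervalV u v ∧ a ≠ u ∧ a ≠ v)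
    (hb : b ∈ G.intervalV u v ∧ b ≠ u ∧ b ≠ v) :
    Relation.ReflTransGen (G.IntervalAdj u v) a b := by
  induction l generalizing a with
  | nil =>
    cases h
    exact Relation.ReflTransGen.refl
  | cons e l ih =>
    obtain ⟨rfl, h⟩ := h
    obtain ⟨⟨⟨k, hk⟩, -⟩, -, -⟩ := id ha
    obtain ⟨⟨-, ⟨k', hk'⟩⟩, -, hbv⟩ := id hb
    have hc : G.tgt e ∈ G.intervalV u v ∧ G.tgt e ≠ u ∧ G.tgt e ≠ v := by
      refine ⟨⟨⟨k ++ [e], hk.append ⟨rfl, rfl⟩⟩, ⟨l ++ k', h.append hk'⟩⟩, ?_, ?_⟩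
      · rintro h'
        exact absurd (hk.time_le.trans_lt (G.time_lt e)) (by rw [h']; exact lt_irrefl _)
      · rintro h'
        have := hk'.eq_or_time_lt.resolve_left hbv
        exact absurd (h.time_le.trans_lt this) (by rw [h']; exact lt_irrefl _)
    exact Relation.ReflTransGen.head ⟨ha, hc, e, Or.inl ⟨rfl, rfl⟩⟩ (ih h hc)

lemma innerV_subset {u v : G.V} {l : List G.E} (h : G.IsTimePath u l v) {a : G.V}
    (ha : a ∈ G.innerV u v l) : a ∈ G.intervalV u v ∧ a ≠ u ∧ a ≠ v := by
  obtain ⟨⟨e, he, hae⟩, hu, hv⟩ := ha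
  refine ⟨?_, hu, hv⟩
  obtain ⟨l₁, l₂, rfl, h₁, h₂⟩ := h.split_at he
  rcases hae with rfl | rfl
  · exact ⟨⟨l₁, h₁⟩, ⟨e :: l₂, rfl, h₂⟩⟩
  · exact ⟨⟨l₁ ++ [e], h₁.append ⟨rfl, rfl⟩⟩, ⟨l₂, h₂⟩⟩

/-- The inner vertices connected with the first side of a truly simple cell. -/
lemma IsTrulySimpleCell.exists_separator {u v : G.V} {l₁ l₂ : List G.E}
    (h : G.IsTrulySimpleCell u v l₁ l₂) :
    ∃ C : Set G.V, G.innerV u v l₁ ⊆ C ∧ Disjoint C (G.innerV u v l₂) ∧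
      (∀ a ∈ C, a ∈ G.intervalV u v ∧ a ≠ u ∧ a ≠ v) ∧
      ∀ a ∈ C, ∀ b, Relation.ReflTransGen (G.IntervalAdj u v) a b → b ∈ C := by
  refine ⟨{b | ∃ a ∈ G.innerV u v l₁, Relation.ReflTransGen (G.IntervalAdj u v) a b},
    fun a ha => ⟨a, ha, .refl⟩, ?_, ?_, ?_⟩
  · rw [Set.disjoint_left]
    rintro b ⟨a, ha, hab⟩ hb
    exact h.separated a ha b hb hab
  · rintro b ⟨a, ha, hab⟩
    rcases Relation.ReflTransGen.cases_tail hab with rfl | ⟨c, -, hc⟩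
    · exact innerV_subset h.path₁ ha
    · exact hc.2.1
  · rintro b ⟨a, ha, hab⟩ c hbc
    exact ⟨a, ha, hab.trans hbc⟩

/-- Converse to `exists_separator`: a set closed under adjacency certifies separation. Cells are
transported by transporting this set. -/
lemma IsCell.isTrulySimpleCell {u v : G.V} {l₁ l₂ : List G.E} (h : G.IsCell u v l₁ l₂)
    {C : Set G.V} (h₁ : G.innerV u v l₁ ⊆ C) (h₂ : Disjoint C (G.innerV u v l₂))
    (hC : ∀ a ∈ C, ∀ b, G.IntervalAdj u v a b → b ∈ C) : G.IsTrulySimpleCell u v l₁ l₂ := by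
  refine ⟨h, fun a ha b hb hab => Set.disjoint_left.1 h₂ ?_ hb⟩
  clear hb
  induction hab with
  | refl => exact h₁ ha
  | tail _ h ih => exact hC _ ih _ h

lemma eq_singleton_of_mem {u v : G.V} {l : List G.E} (h : G.IsTimePath u l v) {e : G.E}
    (he : e ∈ l) (hu : G.src e = u) (hv : G.tgt e = v) : l = [e] := by
  obtain ⟨l₁, l₂, rfl, h₁, h₂⟩ := h.split_at he
  rw [hu] at h₁
  rw [hv] at h₂
  rw [h₁.eq_or_lt.resolve_right (lt_irrefl _), h₂.eq_or_lt.resolve_right (lt_irrefl _)]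
  rfl

/-- An edge which lies on both sides of a cell would be both sides of it. -/
lemma IsCell.not_mem_both {u v : G.V} {l₁ l₂ : List G.E} (h : G.IsCell u v l₁ l₂) (e : G.E)
    (h₁ : e ∈ l₁) (h₂ : e ∈ l₂) : False := by
  obtain ⟨k₁, k₂, -, hk₁, hk₂⟩ := h.path₁.split_at h₁
  have hlt := G.time_lt e
  have hu : G.src e = u := by
    by_contra hu
    have hv : G.src e ≠ v := fun hv => by
      rw [hv] at hlt
      exact absurd (hlt.trans_le hk₂.time_le) (lt_irrefl _)
    exact Set.disjoint_left.1 h.disjoint ⟨⟨e, h₁, Or.inl rfl⟩, hu, hv⟩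
      ⟨⟨e, h₂, Or.inl rfl⟩, hu, hv⟩
  have hv : G.tgt e = v := by
    by_contra hv
    have hu : G.tgt e ≠ u := fun hu => by
      rw [hu] at hlt
      exact absurd (hlt.trans_le hk₁.time_le) (lt_irrefl _)
    exact Set.disjoint_left.1 h.disjoint ⟨⟨e, h₁, Or.inr rfl⟩, hu, hv⟩
      ⟨⟨e, h₂, Or.inr rfl⟩, hu, hv⟩
  exact h.ne ((eq_singleton_of_mem h.path₁ h₁ hu hv).trans
    (eq_singleton_of_mem h.path₂ h₂ hu hv).symm)

end Cells

/-! ### Truly simple cells when an edge is added -/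

namespace EdgeStep

variable {H G : TLG} (s : EdgeStep H G)

lemma mem_innerV_map {u v a : H.V} {l : List H.E} :
    s.onV a ∈ G.innerV (s.onV u) (s.onV v) (l.map fun f => s.onE (some f)) ↔
      a ∈ H.innerV u v l := by
  simp only [innerV, Set.mem_ofPred_eq, List.mem_map, ne_eq, s.onV.injective.eq_iff]
  refine and_congr_left fun _ => ⟨?_, ?_⟩
  · rintro ⟨_, ⟨f, hf, rfl⟩, h⟩
    rw [s.src_old, s.tgt_old, s.onV.injective.eq_iff, s.onV.injective.eq_iff] at h
    exact ⟨f, hf, h⟩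
  · rintro ⟨f, hf, h⟩
    refine ⟨_, ⟨f, hf, rfl⟩, ?_⟩
    rwa [s.src_old, s.tgt_old, s.onV.injective.eq_iff, s.onV.injective.eq_iff]

lemma mem_interior {u v a : H.V} (h : s.onV a ∈ G.intervalV (s.onV u) (s.onV v) ∧
    s.onV a ≠ s.onV u ∧ s.onV a ≠ s.onV v) : a ∈ H.intervalV u v ∧ a ≠ u ∧ a ≠ v := by
  obtain ⟨⟨⟨l, hl⟩, ⟨l', hl'⟩⟩, hu, hv⟩ := h
  exact ⟨⟨s.exists_isTimePath hl, s.exists_isTimePath hl'⟩, fun h => hu (h ▸ rfl),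
    fun h => hv (h ▸ rfl)⟩

/-- Reachability is unchanged, so the interval graph gains no vertices. If the new edge joins two of
its inner vertices, the old time-path between them stays inside, and the separator is still closed
under adjacency. -/
lemma isTrulySimpleCell_map {u v : H.V} {l₁ l₂ : List H.E} (h : H.IsTrulySimpleCell u v l₁ l₂) :
    G.IsTrulySimpleCell (s.onV u) (s.onV v) (l₁.map fun f => s.onE (some f))
      (l₂.map fun f => s.onE (some f)) := by
  obtain ⟨C, hC₁, hC₂, hCi, hC⟩ := h.exists_separator
  refine IsCell.isTrulySimpleCell (C := s.onV '' C)
    ⟨s.isTimePath_map h.path₁, s.isTimePath_map h.path₂, fun he => h.ne ?_, ?_⟩ ?_ ?_ ?_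
  · exact List.map_injective_iff.2
      (s.onE.injective.comp (Option.some_injective _)) he
  · rw [Set.disjoint_left]
    intro a' ha₁ ha₂
    obtain ⟨a, rfl⟩ := s.onV.surjective a'
    rw [mem_innerV_map] at ha₁ ha₂
    exact Set.disjoint_left.1 h.disjoint ha₁ ha₂
  · intro a' ha
    obtain ⟨a, rfl⟩ := s.onV.surjective a'
    exact ⟨a, hC₁ (s.mem_innerV_map.1 ha), rfl⟩
  · rw [Set.disjoint_left]
    rintro _ ⟨a, ha, rfl⟩ ha₂
    exact Set.disjoint_left.1 hC₂ ha (s.mem_innerV_map.1 ha₂)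
  · rintro _ ⟨a, ha, rfl⟩ b' ⟨hai, hbi, e, he⟩
    obtain ⟨b, rfl⟩ := s.onV.surjective b'
    obtain ⟨f, rfl⟩ := s.onE.surjective e
    replace hai := s.mem_interior hai
    replace hbi := s.mem_interior hbi
    refine ⟨b, hC a ha b ?_, rfl⟩
    rcases f with _ | f
    · rw [s.src_new, s.tgt_new, s.onV.injective.eq_iff, s.onV.injective.eq_iff,
        s.onV.injective.eq_iff, s.onV.injective.eq_iff] at he
      rcases he with ⟨h₁, h₂⟩ | ⟨h₁, h₂⟩
      · subst h₁ h₂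
        exact s.isTimePath.reflTransGen_intervalAdj hai hbi
      · subst h₁ h₂
        have : Std.Symm (H.IntervalAdj u v) := ⟨fun _ _ => IntervalAdj.symm⟩
        exact Std.Symm.symm _ _ (s.isTimePath.reflTransGen_intervalAdj hbi hai)
    · rw [s.src_old, s.tgt_old, s.onV.injective.eq_iff, s.onV.injective.eq_iff,
        s.onV.injective.eq_iff, s.onV.injective.eq_iff] at he
      exact .single ⟨hai, hbi, f, he⟩

/-- A new edge is one side of a truly simple cell. -/
lemma isTrulySimpleCell_new : G.IsTrulySimpleCell (s.onV s.u) (s.onV s.v) [s.onE none]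
    (s.path.map fun f => s.onE (some f)) := by
  have hemp : G.innerV (s.onV s.u) (s.onV s.v) [s.onE none] = ∅ := by
    ext a
    simp only [innerV, List.mem_singleton, exists_eq_left, s.src_new, s.tgt_new,
      Set.mem_ofPred_eq, Set.mem_empty_iff_false]
    tauto
  refine ⟨⟨⟨s.src_new, s.tgt_new⟩, s.isTimePath_map s.isTimePath, fun he => ?_, ?_⟩, ?_⟩
  · have : s.onE none ∈ s.path.map fun f => s.onE (some f) := by rw [← he]; simp
    simp at this
  · rw [hemp]
    exact Set.empty_disjoint _
  · rw [hemp]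
    simp

end EdgeStep

/-! ### Truly simple cells when an edge is subdivided -/

namespace VertexStep

variable {H G : TLG} (s : VertexStep H G)

lemma onV_some_inj {a b : H.V} : s.onV (some a) = s.onV (some b) ↔ a = b := by simp

lemma mem_innerV_flatMap {u v a : H.V} {l : List H.E} :
    s.onV (some a) ∈ G.innerV (s.onV (some u)) (s.onV (some v)) (l.flatMap s.cover) ↔
      a ∈ H.innerV u v l := by
  simp only [innerV, Set.mem_ofPred_eq, List.mem_flatMap, ne_eq, onV_some_inj]
  refine and_congr_left fun _ => ⟨?_, ?_⟩
  · rintro ⟨e, ⟨f, hf, he⟩, h⟩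
    refine ⟨f, hf, ?_⟩
    by_cases hfs : f = s.split
    · subst hfs
      rw [s.cover_split] at he
      simp only [List.mem_cons, List.not_mem_nil, or_false] at he
      rcases he with rfl | rfl
      · rw [s.src_fst, s.tgt_fst] at h
        exact Or.inl (by simpa using h)
      · rw [s.src_snd, s.tgt_snd] at h
        exact Or.inr (by simpa using h)
    · rw [s.cover_of_ne hfs, List.mem_singleton] at he
      subst he
      rwa [s.src_old, s.tgt_old, onV_some_inj, onV_some_inj] at h
  · rintro ⟨f, hf, h⟩
    rcases h with h | h
    · obtain ⟨e, he, h'⟩ := (s.isTimePath_cover f).exists_src (s.cover_ne_nil f)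
      exact ⟨e, ⟨f, hf, he⟩, Or.inl (by rw [h', h])⟩
    · obtain ⟨e, he, h'⟩ := (s.isTimePath_cover f).exists_tgt (s.cover_ne_nil f)
      exact ⟨e, ⟨f, hf, he⟩, Or.inr (by rw [h', h])⟩

lemma split_mem {u v : G.V} {l : List H.E} (h : s.onV none ∈ G.innerV u v (l.flatMap s.cover)) :
    s.split ∈ l := by
  obtain ⟨⟨e, he, h⟩, -⟩ := h
  obtain ⟨f, hf, he⟩ := List.mem_flatMap.1 he
  by_cases hfs : f = s.split
  · exact hfs ▸ hf
  · rw [s.cover_of_ne hfs, List.mem_singleton] at he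
    subst he
    rw [s.src_old, s.tgt_old] at h
    simp at h

lemma mem_interior {u v a : H.V} (h : s.onV (some a) ∈
    G.intervalV (s.onV (some u)) (s.onV (some v)) ∧ s.onV (some a) ≠ s.onV (some u) ∧
    s.onV (some a) ≠ s.onV (some v)) : a ∈ H.intervalV u v ∧ a ≠ u ∧ a ≠ v := by
  obtain ⟨⟨⟨l, hl⟩, ⟨l', hl'⟩⟩, hu, hv⟩ := h
  obtain ⟨k, hk, -⟩ := s.exists_lift hl
  obtain ⟨k', hk', -⟩ := s.exists_lift hl'
  exact ⟨⟨⟨k, hk⟩, ⟨k', hk'⟩⟩, fun h => hu (h ▸ rfl), fun h => hv (h ▸ rfl)⟩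

/-- Each cover is nonempty and its first edge determines the covered edge, so a list can be decoded
from the left. -/
lemma flatMap_cover_injective : Function.Injective fun l : List H.E => l.flatMap s.cover := by
  have hhead : ∀ f, ∃ e l, s.cover f = e :: l ∧
      e = s.onE (open Classical in if h : f = s.split then Sum.inr false else Sum.inl ⟨f, h⟩) := by
    intro f
    by_cases h : f = s.split
    · subst h
      exact ⟨_, _, s.cover_split, by simp⟩
    · exact ⟨_, _, s.cover_of_ne h, by simp [h]⟩
  intro l
  induction l with
  | nil =>
    intro k hk
    cases k with
    | nil => rfl
    | cons f k =>
      obtain ⟨e, l, hl, -⟩ := hhead f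
      simp [hl] at hk
  | cons g l ih =>
    intro k hk
    obtain ⟨e, l', hl, he⟩ := hhead g
    cases k with
    | nil => simp [hl] at hk
    | cons f k =>
      obtain ⟨e', l'', hl', he'⟩ := hhead f
      have hee : e = e' := by
        simp only [List.flatMap_cons, hl, hl', List.cons_append, List.cons.injEq] at hk
        exact hk.1
      have hgf : g = f := by
        rw [he, he', s.onE.injective.eq_iff] at hee
        by_cases h₁ : g = s.split <;> by_cases h₂ : f = s.split
        · rw [h₁, h₂]
        · simp [h₁, h₂] at hee
        · simp [h₁, h₂] at hee
        · simpa [h₁, h₂] using hee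
      subst hgf
      simp only [List.flatMap_cons, List.append_cancel_left_eq] at hk
      rw [ih hk]

lemma isTrulySimpleCell_flatMap {u v : H.V} {l₁ l₂ : List H.E}
    (h : H.IsTrulySimpleCell u v l₁ l₂) :
    G.IsTrulySimpleCell (s.onV (some u)) (s.onV (some v)) (l₁.flatMap s.cover)
      (l₂.flatMap s.cover) := by
  obtain ⟨C, hC₁, hC₂, hCi, hC⟩ := h.exists_separator
  -- the side of the new vertex
  let D : Prop := H.src s.split ∈ C ∨ H.tgt s.split ∈ C ∨ s.split ∈ l₁
  have hsrc : H.src s.split ∈ H.intervalV u v ∧ H.src s.split ≠ u ∧ H.src s.split ≠ v →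
      D → H.src s.split ∈ C := by
    rintro hi (h' | h' | h')
    · exact h'
    · exact hC _ h' _ (.single ⟨hCi _ h', hi, s.split, Or.inr ⟨rfl, rfl⟩⟩)
    · exact hC₁ ⟨⟨_, h', Or.inl rfl⟩, hi.2⟩
  have htgt : H.tgt s.split ∈ H.intervalV u v ∧ H.tgt s.split ≠ u ∧ H.tgt s.split ≠ v →
      D → H.tgt s.split ∈ C := by
    rintro hi (h' | h' | h')
    · exact hC _ h' _ (.single ⟨hCi _ h', hi, s.split, Or.inl ⟨rfl, rfl⟩⟩)
    · exact h'
    · exact hC₁ ⟨⟨_, h', Or.inr rfl⟩, hi.2⟩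
  refine IsCell.isTrulySimpleCell (C := {a' | (∃ a ∈ C, a' = s.onV (some a)) ∨
      a' = s.onV none ∧ D})
    ⟨s.isTimePath_flatMap h.path₁, s.isTimePath_flatMap h.path₂,
      fun he => h.ne (s.flatMap_cover_injective he), ?_⟩ ?_ ?_ ?_
  · rw [Set.disjoint_left]
    intro a' ha₁ ha₂
    obtain ⟨_ | a, rfl⟩ := s.onV.surjective a'
    · exact h.not_mem_both _ (s.split_mem ha₁) (s.split_mem ha₂)
    · rw [mem_innerV_flatMap] at ha₁ ha₂
      exact Set.disjoint_left.1 h.disjoint ha₁ ha₂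
  · intro a' ha
    obtain ⟨_ | a, rfl⟩ := s.onV.surjective a'
    · exact Or.inr ⟨rfl, Or.inr (Or.inr (s.split_mem ha))⟩
    · exact Or.inl ⟨a, hC₁ (s.mem_innerV_flatMap.1 ha), rfl⟩
  · rw [Set.disjoint_left]
    rintro _ (⟨a, ha, rfl⟩ | ⟨rfl, hD⟩) ha₂
    · exact Set.disjoint_left.1 hC₂ ha (s.mem_innerV_flatMap.1 ha₂)
    · have h₂ := s.split_mem ha₂
      rcases hD with h' | h' | h'
      · exact Set.disjoint_left.1 hC₂ h' ⟨⟨_, h₂, Or.inl rfl⟩, (hCi _ h').2⟩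
      · exact Set.disjoint_left.1 hC₂ h' ⟨⟨_, h₂, Or.inr rfl⟩, (hCi _ h').2⟩
      · exact h.not_mem_both _ h' h₂
  · rintro a' ha' b' ⟨hai, hbi, e, he⟩
    obtain ⟨f, rfl⟩ := s.onE.surjective e
    rcases f with ⟨f, hf⟩ | _ | _
    · rw [s.src_old, s.tgt_old] at he
      have : ∃ a b, a' = s.onV (some a) ∧ b' = s.onV (some b) ∧
          ((H.src f = a ∧ H.tgt f = b) ∨ (H.src f = b ∧ H.tgt f = a)) := by
        rcases he with ⟨h₁, h₂⟩ | ⟨h₁, h₂⟩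
        · exact ⟨_, _, h₁.symm, h₂.symm, Or.inl ⟨rfl, rfl⟩⟩
        · exact ⟨_, _, h₂.symm, h₁.symm, Or.inr ⟨rfl, rfl⟩⟩
      clear he
      obtain ⟨a, b, rfl, rfl, he⟩ := this
      rcases ha' with ⟨a₁, ha, haa⟩ | ⟨h', -⟩
      · rw [onV_some_inj] at haa
        subst haa
        exact Or.inl ⟨b, hC a ha b (.single
          ⟨s.mem_interior hai, s.mem_interior hbi, f, he⟩), rfl⟩
      · simp at h'
    · rw [s.src_fst, s.tgt_fst] at he
      rcases he with ⟨rfl, rfl⟩ | ⟨rfl, rfl⟩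
      · rcases ha' with ⟨a₁, ha, haa⟩ | ⟨h', -⟩
        · rw [onV_some_inj] at haa
          subst haa
          exact Or.inr ⟨rfl, Or.inl ha⟩
        · simp at h'
      · rcases ha' with ⟨a₁, ha, haa⟩ | ⟨-, hD⟩
        · simp at haa
        · exact Or.inl ⟨_, hsrc (s.mem_interior hbi) hD, rfl⟩
    · rw [s.src_snd, s.tgt_snd] at he
      rcases he with ⟨rfl, rfl⟩ | ⟨rfl, rfl⟩
      · rcases ha' with ⟨a₁, ha, haa⟩ | ⟨-, hD⟩
        · simp at haa
        · exact Or.inl ⟨_, htgt (s.mem_interior hbi) hD, rfl⟩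
      · rcases ha' with ⟨a₁, ha, haa⟩ | ⟨h', -⟩
        · rw [onV_some_inj] at haa
          subst haa
          exact Or.inr ⟨rfl, Or.inr (Or.inl ha)⟩
        · simp at h'

end VertexStep

/-! ### The law of a natural process along the full paths -/

section Family

variable {G H : TLG} {S : Type*} [MeasurableSpace S] {M : G.PathFamily S}

/-- Consistency concerns the full coincidence set; a further restriction gives every subset of it.
-/
lemma IsMarkovFamily.map_domRestrict (hM : IsMarkovFamily M) {σ₁ σ₂ : G.FullPath}
    {A : Set unitInterval} (h : ∀ t ∈ A, σ₁.point t = σ₂.point t) :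
    (M σ₁).map (Set.domRestrict A) = (M σ₂).map (Set.domRestrict A) := by
  have e : (Set.domRestrict A : (unitInterval → S) → A → S) = (fun (y : {t | σ₁.point t = σ₂.point t} → S) (t : A) =>
      y ⟨t, h t t.2⟩) ∘ Set.domRestrict {t | σ₁.point t = σ₂.point t} := rfl
  have m : Measurable fun (y : {t | σ₁.point t = σ₂.point t} → S) (t : A) => y ⟨t, h t t.2⟩ :=
    measurable_pi_lambda _ fun t => measurable_pi_apply _
  have m' : Measurable (Set.domRestrict (π := fun _ => S) {t | σ₁.point t = σ₂.point t}) :=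
    measurable_pi_lambda _ fun t => measurable_pi_apply _
  rw [e, ← Measure.map_map m m', ← Measure.map_map m m', hM.consistent σ₁ σ₂]

lemma IsMarkovFamily.comap (hM : IsMarkovFamily M) {φ : H.FullPath → G.FullPath}
    {ψ : H.Point → G.Point} (h : ∀ σ t, (φ σ).point t = ψ (σ.point t)) :
    IsMarkovFamily fun σ => M (φ σ) :=
  ⟨fun σ₁ σ₂ => hM.map_domRestrict fun t (ht : σ₁.point t = σ₂.point t) => by rw [h, h, ht],
    fun σ => hM.markov (φ σ)⟩

end Family

section Constructed

variable {S : Type*} [MeasurableSpace S] {Ω : Type*} [MeasurableSpace Ω] {P : Measure Ω}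
  [IsProbabilityMeasure P]

namespace EdgeStep

variable {H G : TLG} (s : EdgeStep H G) {M : G.PathFamily S} {X : G.Point → Ω → S}

/-- Along a full path through the new edge the process has the prescribed law, if it does so along
the full paths of the smaller graph. -/
lemma map_point_of_mem (hM : IsMarkovFamily M) (hXm : ∀ p, Measurable (X p))
    (hnew : s.NewEdgeLaw P M X)
    (hold : ∀ σ : H.FullPath,
      P.map (fun ω t => X (s.toPoint (σ.point t)) ω) = M (s.toFullPath σ))
    (σ : G.FullPath) (hσ : s.onE none ∈ σ.1) :
    P.map (fun ω t => X (σ.point t) ω) = M σ := by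
  obtain ⟨σ₀, hσ₀, κ, hκ, hlaw, hX⟩ := hnew
  obtain ⟨σ', hu, hv, hout⟩ := s.exists_detour σ hσ
  have := (hM.markov σ).prob
  let a := H.time s.u
  let b := H.time s.v
  have hab : a < b := s.time_u_lt
  let Out : Set unitInterval := Set.Iic a ∪ Set.Ici b
  let In : Set unitInterval := Set.Icc a b
  have hin : ∀ σ : G.FullPath, s.onE none ∈ σ.1 → ∀ t ∈ In,
      σ.point t = G.edgePoint (s.onE none) t := fun σ hσ t ht =>
    σ.point_eq hσ (by rwa [s.time_src_new, s.time_tgt_new])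
  let a' : Out := ⟨a, Or.inl (le_refl a)⟩
  let b' : Out := ⟨b, Or.inr (le_refl b)⟩
  let a'' : In := ⟨a, le_rfl, hab.le⟩
  let b'' : In := ⟨b, hab.le, le_rfl⟩
  let g : (Out → S) → S × S := fun z => (z a', z b')
  have hg : Measurable g := by fun_prop
  let Z : (unitInterval → S) → Out → S := Set.domRestrict Out
  let Y : (unitInterval → S) → In → S := Set.domRestrict In
  have hZ : Measurable Z := measurable_pi_lambda _ fun t => measurable_pi_apply _
  have hY : Measurable Y := measurable_pi_lambda _ fun t => measurable_pi_apply _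
  have hc (t : unitInterval) : Measurable fun y : unitInterval → S => y t :=
    measurable_pi_apply t
  -- under the prescribed law
  have h1 : (M σ).map (fun y => (g (Z y), Y y)) = (M σ).map (fun y => g (Z y)) ⊗ₘ κ := by
    -- The construction uses its own path σ₀. Both paths contain the new edge, so consistency
    -- transfers the conditional law from σ₀ to σ.
    have hYY : (M σ).map Y = (M σ₀).map Y :=
      hM.map_domRestrict fun t ht => by rw [hin σ hσ t ht, hin σ₀ hσ₀ t ht]
    have m1 : Measurable fun y : In → S => ((y a'', y b''), y) := by fun_prop
    have m2 : Measurable fun y : In → S => (y a'', y b'') := by fun_prop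
    have e1 : (fun y => (g (Z y), Y y)) = (fun y : In → S => ((y a'', y b''), y)) ∘ Y := rfl
    have e2 : (fun y => g (Z y)) = (fun y : In → S => (y a'', y b'')) ∘ Y := rfl
    rw [e1, e2, ← Measure.map_map m1 hY, ← Measure.map_map m2 hY, hYY, Measure.map_map m1 hY,
      Measure.map_map m2 hY]
    exact hlaw
  have h2 : CondIndepGiven (M σ) (MeasurableSpace.comap Y inferInstance)
      (MeasurableSpace.comap Z inferInstance)
      (MeasurableSpace.comap (fun y => g (Z y)) inferInstance) := by
    -- The times a and b separate the interval of the edge from all other times.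
    have := condIndepOn_of_markov (P := M σ) hc (hM.markov σ).markov {a, b} In Out (by
      intro t ht t' ht'
      rcases ht' with h | h
      · exact ⟨a, by simp, Set.mem_uIcc.2 (Or.inr ⟨h, ht.1⟩)⟩
      · exact ⟨b, by simp, Set.mem_uIcc.2 (Or.inl ⟨ht.2, h⟩)⟩)
    unfold CondIndepOn at this
    rw [sigmaOn_eq_comap _ In, sigmaOn_eq_comap _ Out] at this
    have e : sigmaOn (fun t (y : unitInterval → S) => y t) (({a, b} : Finset unitInterval) :
        Set unitInterval) = MeasurableSpace.comap (fun y => g (Z y)) inferInstance := by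
      have : (({a, b} : Finset unitInterval) : Set unitInterval) = {a} ∪ {b} := by
        rw [Finset.coe_pair, Set.insert_eq]
      rw [this, sigmaOn_union, sigmaOn, sigmaOn, iSup_singleton, iSup_singleton]
      exact (MeasurableSpace.comap_prodMk _ _).symm
    rw [e] at this
    exact this
  have h3 := map_eq_compProd_of_condIndepGiven hZ hY hg h1 h2
  -- under the law of `X`
  let XH : Ω → H.Point → S := fun ω p => X (s.toPoint p) ω
  have hXH : Measurable XH := measurable_pi_lambda _ fun p => hXm _
  let Ye : Ω → In → S := fun ω t => X (G.edgePoint (s.onE none) t) ω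
  have hYe : Measurable Ye := measurable_pi_lambda _ fun p => hXm _
  let h : (H.Point → S) → Out → S := fun x t => x (σ'.point t)
  have hh : Measurable h := measurable_pi_lambda _ fun t => measurable_pi_apply _
  have := Measure.isProbabilityMeasure_map (μ := P) hXH.aemeasurable
  have h4 : P.map (fun ω => (h (XH ω), Ye ω)) = (P.map XH).map h ⊗ₘ κ.comap g hg := by
    -- The detour passes through u and v, so its values at times a and b are those at the endpoints
    -- of the new edge.
    have e : (κ.comap g hg).comap h hh =
        κ.comap (fun x : H.Point → S => (x (.vertex s.u), x (.vertex s.v))) (by fun_prop) := by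
      ext x
      simp only [Kernel.comap_apply]
      rw [← hu, ← hv]
    have e' : (fun ω => (h (XH ω), Ye ω)) = Prod.map h id ∘ fun ω => (XH ω, Ye ω) := rfl
    rw [compProd_map_left hh, e, e', ← Measure.map_map (hh.prodMap measurable_id)
      (hXH.prodMk hYe)]
    exact congrArg _ hX
  have h5 : (P.map XH).map h = (M σ).map Z := by
    have e : (M σ).map Z = (M (s.toFullPath σ')).map Z :=
      hM.map_domRestrict fun t ht => by rw [hout t ht, s.toFullPath_point]
    rw [e, ← hold σ', Measure.map_map hh hXH,
      Measure.map_map hZ (measurable_pi_lambda _ fun t => hXm _)]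
    rfl
  have h6 : P.map (fun ω => (h (XH ω), Ye ω)) = (M σ).map fun y => (Z y, Y y) := by
    rw [h3, h4, h5]
  have hnot : ∀ t, t ∉ In → t ∈ Out := fun t ht => by
    by_contra h
    rw [Set.mem_union, not_or] at h
    exact ht ⟨(not_le.1 h.1).le, (not_le.1 h.2).le⟩
  classical
  -- A trajectory is reassembled from its two pieces. They overlap at a and b, where the piece on
  -- the edge is used.
  let F : (Out → S) × (In → S) → unitInterval → S := fun q t =>
    if ht : t ∈ In then q.2 ⟨t, ht⟩ else q.1 ⟨t, hnot t ht⟩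
  have hF : Measurable F := by
    refine measurable_pi_lambda _ fun t => ?_
    by_cases ht : t ∈ In
    · simp only [F, ht, dite_true]
      fun_prop
    · simp only [F, ht, dite_false]
      fun_prop
  have e1 : (fun ω t => X (σ.point t) ω) = F ∘ fun ω => (h (XH ω), Ye ω) := by
    ext ω t
    by_cases ht : t ∈ In
    · simp only [F, Function.comp, ht, dite_true, Ye, hin σ hσ t ht]
    · simp only [F, Function.comp, ht, dite_false, h, XH, hout t (hnot t ht)]
  have e2 : F ∘ (fun y => (Z y, Y y)) = id := by
    ext y t
    by_cases ht : t ∈ In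
    · simp only [F, Function.comp, ht, dite_true, Y, id, Set.domRestrict_apply]
    · simp only [F, Function.comp, ht, dite_false, Z, id, Set.domRestrict_apply]
  have hm : Measurable fun ω => (h (XH ω), Ye ω) := (hh.comp hXH).prodMk hYe
  rw [e1, ← Measure.map_map hF hm, h6, Measure.map_map hF (hZ.prodMk hY),
    e2, Measure.map_id]

/-- The process on the new edge and the process on the smaller graph are conditionally independent
given the values at the endpoints of the new edge. -/
lemma condIndepOn_new (hXm : ∀ p, Measurable (X p)) (hnew : s.NewEdgeLaw P M X) :
    CondIndepOn P X (Set.range s.toPoint)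
      (G.edgePoint (s.onE none) '' Set.Icc (H.time s.u) (H.time s.v))
      {.vertex (s.onV s.u), .vertex (s.onV s.v)} := by
  obtain ⟨σ₀, hσ₀, κ, hκ, hlaw, hX⟩ := hnew
  have := condIndepGiven_of_map_eq_compProd (measurable_pi_lambda _ fun p => hXm _)
    (measurable_pi_lambda _ fun p => hXm _) _ hX
  refine CondIndepGiven.symm ?_
  convert this using 1
  · rw [← sigmaOn_comp_right, sigmaOn_eq_comap]
  · rw [sigmaOn_range]
  · rw [Set.insert_eq, sigmaOn_union, sigmaOn, sigmaOn, iSup_singleton, iSup_singleton]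
    exact (MeasurableSpace.comap_prodMk _ _).symm

end EdgeStep

/-- A constructed process has the prescribed law along each full path. -/
theorem Tower.IsConstructed.map_point {G : TLG} (T : Tower G) {M : G.PathFamily S}
    {X : G.Point → Ω → S} (hM : IsMarkovFamily M) (hXm : ∀ p, Measurable (X p))
    (hX : T.IsConstructed P M X) (σ : G.FullPath) :
    P.map (fun ω t => X (σ.point t) ω) = M σ := by
  induction T with
  | minimal h => exact hX σ
  | addVertex T s ih =>
    obtain ⟨σ', rfl⟩ := s.exists_toFullPath_eq σ
    simp only [s.toFullPath_point]
    exact ih (hM.comap s.toFullPath_point) (fun p => hXm _) hX σ'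
  | addEdge T s ih =>
    have hold := ih (hM.comap s.toFullPath_point) (fun p => hXm _) hX.1
    by_cases hσ : s.onE none ∈ σ.1
    · exact s.map_point_of_mem hM hXm hX.2 hold σ hσ
    · obtain ⟨σ', rfl⟩ := s.exists_toFullPath_eq σ hσ
      simp only [s.toFullPath_point]
      exact hold σ'

end Constructed

end TLG

lemma CondIndepOn.comp {Ω S T T' : Type*} [MeasurableSpace S] [MeasurableSpace Ω]
    {P : Measure Ω} {X : T → Ω → S} {f : T' → T} {A B C : Set T}
    (h : CondIndepOn P (fun t => X (f t)) (f ⁻¹' A) (f ⁻¹' B) (f ⁻¹' C)) :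
    CondIndepOn P X (A ∩ Set.range f) (B ∩ Set.range f) (C ∩ Set.range f) := by
  have key (V : Set T) :
      sigmaOn (fun t => X (f t)) (f ⁻¹' V) = sigmaOn X (V ∩ Set.range f) := by
    rw [sigmaOn_comp_right X f, Set.image_preimage_eq_inter_range]
  unfold CondIndepOn at h ⊢
  rwa [key, key, key] at h

namespace TLG

/-! ### Separation -/

/-- `W` separates `U₁` from `U₂` along each edge, and no truly simple cell leads from one of them to
the other. -/
structure Separates (G : TLG) (W U₁ U₂ : Set G.Point) : Prop where
  cover : ∀ p, p ∈ U₁ ∨ p ∈ U₂ ∨ p ∈ W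
  finite : ∀ e, {τ ∈ Set.Icc (G.time (G.src e)) (G.time (G.tgt e)) | G.edgePoint e τ ∈ W}.Finite
  edge : ∀ e, ∀ a ∈ Set.Icc (G.time (G.src e)) (G.time (G.tgt e)),
    ∀ b ∈ Set.Icc (G.time (G.src e)) (G.time (G.tgt e)), G.edgePoint e a ∈ U₁ →
      G.edgePoint e b ∈ U₂ → ∃ w ∈ Set.uIcc a b, G.edgePoint e w ∈ W
  cell : ∀ u v l₁ l₂, G.IsTrulySimpleCell u v l₁ l₂ →
    ¬ (.vertex u ∈ U₁ ∧ .vertex v ∈ U₂) ∧ ¬ (.vertex u ∈ U₂ ∧ .vertex v ∈ U₁)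

lemma Separates.symm {G : TLG} {W U₁ U₂ : Set G.Point} (h : G.Separates W U₁ U₂) :
    G.Separates W U₂ U₁ where
  cover p := by have := h.cover p; tauto
  finite := h.finite
  edge e a ha b hb ha' hb' := by
    obtain ⟨w, hw, hW⟩ := h.edge e b hb a ha hb' ha'
    exact ⟨w, Set.uIcc_comm a b ▸ hw, hW⟩
  cell u v l₁ l₂ hc := (h.cell u v l₁ l₂ hc).symm

/-- The essential field is `cell`: it is inherited because cells of the smaller graph persist in the
larger one. -/
lemma EdgeStep.separates {H G : TLG} (s : EdgeStep H G) {W U₁ U₂ : Set G.Point}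
    (h : G.Separates W U₁ U₂) :
    H.Separates (s.toPoint ⁻¹' W) (s.toPoint ⁻¹' U₁) (s.toPoint ⁻¹' U₂) where
  cover p := h.cover _
  finite f := by
    have := h.finite (s.onE (some f))
    simpa only [s.time_src, s.time_tgt, Set.mem_preimage, s.toPoint_edgePoint] using this
  edge f := by
    have := h.edge (s.onE (some f))
    simpa only [s.time_src, s.time_tgt, Set.mem_preimage, s.toPoint_edgePoint] using this
  cell u v l₁ l₂ hc := h.cell _ _ _ _ (s.isTrulySimpleCell_map hc)

/-- Two points of an edge are on the same half of it, or the new vertex is between them. -/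
lemma VertexStep.exists_between {H G : TLG} (s : VertexStep H G) {f : H.E} {a b : unitInterval}
    (ha : a ∈ Set.Icc (H.time (H.src f)) (H.time (H.tgt f)))
    (hb : b ∈ Set.Icc (H.time (H.src f)) (H.time (H.tgt f))) :
    ∃ e ∈ s.cover f, ∃ e' ∈ s.cover f, ∃ c ∈ Set.uIcc a b,
      a ∈ Set.Icc (G.time (G.src e)) (G.time (G.tgt e)) ∧
      c ∈ Set.Icc (G.time (G.src e)) (G.time (G.tgt e)) ∧
      c ∈ Set.Icc (G.time (G.src e')) (G.time (G.tgt e')) ∧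
      b ∈ Set.Icc (G.time (G.src e')) (G.time (G.tgt e')) := by
  obtain ⟨e, he, hae⟩ := s.exists_mem_cover ha
  obtain ⟨e', he', hbe⟩ := s.exists_mem_cover hb
  by_cases h : e = e'
  · subst h
    exact ⟨e, he, e, he, a, Set.left_mem_uIcc, hae, hae, hae, hbe⟩
  refine ⟨e, he, e', he', G.time (s.onV none), ?_⟩
  by_cases hf : f = s.split
  · subst hf
    rw [s.cover_split] at he he'
    simp only [List.mem_cons, List.not_mem_nil, or_false] at he he'
    have h1 := G.time_lt (s.onE (Sum.inr false))
    have h2 := G.time_lt (s.onE (Sum.inr true))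
    rw [s.tgt_fst] at h1
    rw [s.src_snd] at h2
    rcases he with rfl | rfl <;> rcases he' with rfl | rfl
    · exact absurd rfl h
    · rw [s.tgt_fst] at hae ⊢
      rw [s.src_snd] at hbe ⊢
      exact ⟨Set.mem_uIcc.2 (Or.inl ⟨hae.2, hbe.1⟩), hae, ⟨h1.le, le_rfl⟩, ⟨le_rfl, h2.le⟩, hbe⟩
    · rw [s.tgt_fst] at hbe ⊢
      rw [s.src_snd] at hae ⊢
      exact ⟨Set.mem_uIcc.2 (Or.inr ⟨hbe.2, hae.1⟩), hae, ⟨le_rfl, h2.le⟩, ⟨h1.le, le_rfl⟩, hbe⟩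
    · exact absurd rfl h
  · rw [s.cover_of_ne hf, List.mem_singleton] at he he'
    exact absurd (he.trans he'.symm) h

lemma VertexStep.separates {H G : TLG} (s : VertexStep H G) {W U₁ U₂ : Set G.Point}
    (h : G.Separates W U₁ U₂) :
    H.Separates (s.toPoint ⁻¹' W) (s.toPoint ⁻¹' U₁) (s.toPoint ⁻¹' U₂) where
  cover p := h.cover _
  finite f := by
    refine ((s.cover f).finite_toSet.biUnion fun e _ => h.finite e).subset ?_
    rintro τ ⟨hτ, hW⟩
    obtain ⟨e, he, hτe⟩ := s.exists_mem_cover hτ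
    rw [Set.mem_preimage, s.toPoint_edgePoint he hτe] at hW
    exact Set.mem_biUnion he ⟨hτe, hW⟩
  edge f a ha b hb ha₁ hb₂ := by
    obtain ⟨e, he, e', he', c, hc, hae, hce, hce', hbe'⟩ := s.exists_between ha hb
    have hsub {x y : unitInterval} {e : G.E}
        (hx : x ∈ Set.Icc (G.time (G.src e)) (G.time (G.tgt e)))
        (hy : y ∈ Set.Icc (G.time (G.src e)) (G.time (G.tgt e))) :=
      Set.uIcc_subset_Icc hx hy
    -- The intermediate point c, shared by the two pieces, may lie in W. Otherwise it lies in U₁ or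
    -- U₂, and one of the pieces then joins U₁ to U₂ and meets W.
    rcases h.cover (s.toPoint (H.edgePoint f c)) with h' | h' | h'
    · rw [Set.mem_preimage, s.toPoint_edgePoint he' hbe'] at hb₂
      rw [s.toPoint_edgePoint he' hce'] at h'
      obtain ⟨w, hw, hW⟩ := h.edge e' c hce' b hbe' h' hb₂
      refine ⟨w, Set.uIcc_subset_uIcc hc Set.right_mem_uIcc hw, ?_⟩
      rwa [Set.mem_preimage, s.toPoint_edgePoint he' (hsub hce' hbe' hw)]
    · rw [Set.mem_preimage, s.toPoint_edgePoint he hae] at ha₁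
      rw [s.toPoint_edgePoint he hce] at h'
      obtain ⟨w, hw, hW⟩ := h.edge e a hae c hce ha₁ h'
      refine ⟨w, Set.uIcc_subset_uIcc Set.left_mem_uIcc hc hw, ?_⟩
      rwa [Set.mem_preimage, s.toPoint_edgePoint he (hsub hae hce hw)]
    · exact ⟨c, hc, h'⟩
  cell u v l₁ l₂ hc := h.cell _ _ _ _ (s.isTrulySimpleCell_flatMap hc)

/-! ### The separation theorem along a tower -/

section Constructed

variable {S : Type*} [MeasurableSpace S] {Ω : Type*} [MeasurableSpace Ω] {P : Measure Ω}
  [IsProbabilityMeasure P]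

/-- Separation along an edge of a path on which the process is Markov. -/
lemma Separates.condIndepOn_edge {G : TLG} {W U₁ U₂ : Set G.Point} (h : G.Separates W U₁ U₂)
    {X : G.Point → Ω → S} (hXm : ∀ p, Measurable (X p)) {μ : Measure (unitInterval → S)}
    (hμ : IsMarkovLaw μ) (σ : G.FullPath) (hσ : P.map (fun ω t => X (σ.point t) ω) = μ)
    {e : G.E} (he : e ∈ σ.1) {E : Set G.Point}
    (hE : E = G.edgePoint e '' Set.Icc (G.time (G.src e)) (G.time (G.tgt e))) :
    CondIndepOn P X (U₁ ∩ E) (U₂ ∩ E) (W ∩ E) := by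
  have hM : ∀ t, CondIndepOn P (fun t => X (σ.point t)) (Set.Iic t) (Set.Ici t) {t} := fun t =>
    condIndepOn_of_map (fun t => hXm _) (hσ ▸ hμ.markov t)
  have key (V : Set G.Point) : sigmaOn X (V ∩ E) = sigmaOn (fun t => X (σ.point t))
      {τ ∈ Set.Icc (G.time (G.src e)) (G.time (G.tgt e)) | G.edgePoint e τ ∈ V} := by
    rw [sigmaOn_comp_right X σ.point, hE]
    refine congrArg (sigmaOn X) ?_
    ext p
    constructor
    · rintro ⟨hp, τ, hτ, rfl⟩
      exact ⟨τ, ⟨hτ, hp⟩, σ.point_eq he hτ⟩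
    · rintro ⟨τ, ⟨hτ, hp⟩, rfl⟩
      rw [σ.point_eq he hτ]
      exact ⟨hp, τ, hτ, rfl⟩
  have := condIndepOn_of_markov (fun t => hXm _) hM (h.finite e).toFinset
    {τ ∈ Set.Icc (G.time (G.src e)) (G.time (G.tgt e)) | G.edgePoint e τ ∈ U₁}
    {τ ∈ Set.Icc (G.time (G.src e)) (G.time (G.tgt e)) | G.edgePoint e τ ∈ U₂} (by
      rintro a ⟨ha, ha'⟩ b ⟨hb, hb'⟩
      obtain ⟨w, hw, hW⟩ := h.edge e a ha b hb ha' hb'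
      exact ⟨w, by simpa using ⟨Set.uIcc_subset_Icc ha hb hw, hW⟩, hw⟩)
  rw [Set.Finite.coe_toFinset] at this
  unfold CondIndepOn at this ⊢
  rwa [key, key, key]

lemma IsMinimal.condIndepOn {G : TLG} (hG : G.IsMinimal) {M : G.PathFamily S}
    (hM : IsMarkovFamily M) {X : G.Point → Ω → S} (hXm : ∀ p, Measurable (X p))
    (hX : ∀ σ : G.FullPath, P.map (fun ω t => X (σ.point t) ω) = M σ)
    {W U₁ U₂ : Set G.Point} (h : G.Separates W U₁ U₂) : CondIndepOn P X U₁ U₂ W := by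
  obtain ⟨e, h₀, h₁, he⟩ := hG.edges
  let σ : G.FullPath := ⟨[e], h₀, h₁⟩
  have hE : Set.univ = G.edgePoint e '' Set.Icc (G.time (G.src e)) (G.time (G.tgt e)) := by
    refine (Set.eq_univ_of_forall fun p => ?_).symm
    rcases eq_vertex_or_eq_edgePoint p with ⟨v, rfl⟩ | ⟨f, τ, hτ, rfl⟩
    · rcases hG.vertices v with rfl | rfl
      · exact ⟨_, ⟨le_rfl, (G.time_lt e).le⟩, by rw [edgePoint_src, h₀]⟩
      · exact ⟨_, ⟨(G.time_lt e).le, le_rfl⟩, by rw [edgePoint_tgt, h₁]⟩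
    · rw [he f] at hτ ⊢
      exact ⟨τ, hτ, rfl⟩
  have := h.condIndepOn_edge hXm (hM.markov σ) σ (hX σ) (by simp [σ]) hE
  simpa only [Set.inter_univ] using this

lemma VertexStep.range_toPoint {H G : TLG} (s : VertexStep H G) :
    Set.range s.toPoint = Set.univ := by
  refine Set.eq_univ_of_forall fun p => ?_
  have hedge : ∀ e, ∀ τ ∈ Set.Icc (G.time (G.src e)) (G.time (G.tgt e)),
      G.edgePoint e τ ∈ Set.range s.toPoint := by
    intro e τ hτ
    have : ∃ f, e ∈ s.cover f := by
      obtain ⟨f, rfl⟩ := s.onE.surjective e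
      rcases f with ⟨f, hf⟩ | _ | _
      · exact ⟨f, by simp [s.cover_of_ne hf]⟩
      · exact ⟨s.split, by simp [s.cover_split]⟩
      · exact ⟨s.split, by simp [s.cover_split]⟩
    obtain ⟨f, hf⟩ := this
    exact ⟨_, s.toPoint_edgePoint hf hτ⟩
  rcases eq_vertex_or_eq_edgePoint p with ⟨v, rfl⟩ | ⟨e, τ, hτ, rfl⟩
  · obtain ⟨_ | v, rfl⟩ := s.onV.surjective v
    · rw [← s.tgt_fst, ← edgePoint_tgt]
      exact hedge _ _ ⟨(G.time_lt _).le, le_rfl⟩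
    · exact ⟨.vertex v, rfl⟩
  · exact hedge e τ hτ

lemma EdgeStep.mem_range_or_mem {H G : TLG} (s : EdgeStep H G) (p : G.Point) :
    p ∈ Set.range s.toPoint ∨
      p ∈ G.edgePoint (s.onE none) '' Set.Icc (H.time s.u) (H.time s.v) := by
  rcases eq_vertex_or_eq_edgePoint p with ⟨v, rfl⟩ | ⟨e, τ, hτ, rfl⟩
  · obtain ⟨v, rfl⟩ := s.onV.surjective v
    exact Or.inl ⟨.vertex v, rfl⟩
  · obtain ⟨_ | f, rfl⟩ := s.onE.surjective e
    · rw [s.time_src_new, s.time_tgt_new] at hτ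
      exact Or.inr ⟨τ, hτ, rfl⟩
    · exact Or.inl ⟨_, s.toPoint_edgePoint f τ⟩

/-- `CondIndepOn.glue` is applied to the points of H and the closed new edge, with the two endpoints
as interface. The endpoints belong to both parts, and `hD` says that the interface is not split. -/
lemma EdgeStep.condIndepOn {H G : TLG} (s : EdgeStep H G) {X : G.Point → Ω → S}
    (hXm : ∀ p, Measurable (X p)) {M : G.PathFamily S} (hM : IsMarkovFamily M)
    (hnew : s.NewEdgeLaw P M X)
    (hlaw : ∀ σ : G.FullPath, P.map (fun ω t => X (σ.point t) ω) = M σ)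
    {W U₁ U₂ : Set G.Point} (h : G.Separates W U₁ U₂)
    (hH : CondIndepOn P (fun p => X (s.toPoint p)) (s.toPoint ⁻¹' U₁) (s.toPoint ⁻¹' U₂)
      (s.toPoint ⁻¹' W))
    (hD : ({.vertex (s.onV s.u), .vertex (s.onV s.v)} : Set G.Point) ⊆ U₁ ∪ W) :
    CondIndepOn P X U₁ U₂ W := by
  let R := Set.range s.toPoint
  let E := G.edgePoint (s.onE none) '' Set.Icc (H.time s.u) (H.time s.v)
  have hE : E = G.edgePoint (s.onE none) ''
      Set.Icc (G.time (G.src (s.onE none))) (G.time (G.tgt (s.onE none))) := by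
    rw [s.time_src_new, s.time_tgt_new]
  have hRE : R ∪ E = Set.univ := Set.eq_univ_of_forall s.mem_range_or_mem
  have hcov : U₁ ∪ U₂ ∪ W = Set.univ := Set.eq_univ_of_forall fun p => by
    have := h.cover p
    simp only [Set.mem_union]
    tauto
  obtain ⟨σ₀, hσ₀, -⟩ := id hnew
  have hB := h.condIndepOn_edge hXm (hM.markov σ₀) σ₀ (hlaw σ₀) hσ₀ hE
  have hA := hH.comp
  have hAB := s.condIndepOn_new hXm hnew
  have hsplit (V : Set G.Point) : V = V ∩ R ∪ V ∩ E := by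
    rw [← Set.inter_union_distrib_left, hRE, Set.inter_univ]
  have hsub (V : Set G.Point) : V = U₁ ∩ V ∪ U₂ ∩ V ∪ W ∩ V := by
    rw [← Set.union_inter_distrib_right, ← Set.union_inter_distrib_right, hcov, Set.univ_inter]
  rw [hsplit U₁, hsplit U₂, hsplit W]
  refine CondIndepOn.glue hXm (D := {.vertex (s.onV s.u), .vertex (s.onV s.v)}) ?_ ?_ ?_ hA hB
  · rw [← hsub, ← hsub]
    exact hAB
  · rw [← Set.union_inter_distrib_right]
    refine Set.subset_inter hD ?_
    rintro _ (rfl | rfl)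
    · exact ⟨.vertex s.u, rfl⟩
    · exact ⟨.vertex s.v, rfl⟩
  · rw [← Set.union_inter_distrib_right]
    refine Set.subset_inter hD ?_
    rintro _ (rfl | rfl)
    · exact ⟨H.time s.u, ⟨le_rfl, s.time_u_lt.le⟩,
        by rw [← s.time_src_new, edgePoint_src, s.src_new]⟩
    · exact ⟨H.time s.v, ⟨s.time_u_lt.le, le_rfl⟩,
        by rw [← s.time_tgt_new, edgePoint_tgt, s.tgt_new]⟩

theorem Tower.IsConstructed.condIndepOn {G : TLG} (T : Tower G) {M : G.PathFamily S}
    {X : G.Point → Ω → S} (hM : IsMarkovFamily M) (hXm : ∀ p, Measurable (X p))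
    (hX : T.IsConstructed P M X) {W U₁ U₂ : Set G.Point} (h : G.Separates W U₁ U₂) :
    CondIndepOn P X U₁ U₂ W := by
  induction T with
  | minimal hG => exact hG.condIndepOn hM hXm hX h
  | addVertex T s ih =>
    have := (ih (hM.comap s.toFullPath_point) (fun p => hXm _) hX (s.separates h)).comp
    simpa only [s.range_toPoint, Set.inter_univ] using this
  | addEdge T s ih =>
    have hH := ih (hM.comap s.toFullPath_point) (fun p => hXm _) hX.1 (s.separates h)
    have hlaw := Tower.IsConstructed.map_point (.addEdge T s) hM hXm hX
    have hcell := h.cell _ _ _ _ s.isTrulySimpleCell_new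
    by_cases hD : ({.vertex (s.onV s.u), .vertex (s.onV s.v)} : Set _) ⊆ U₁ ∪ W
    · exact s.condIndepOn hXm hM hX.2 hlaw h hH hD
    -- One endpoint is in neither U₁ nor W, hence in U₂. By the cell formed by the new edge the
    -- other cannot lie in U₁, so both lie in U₂ ∪ W and the roles are exchanged.
    · refine (s.condIndepOn hXm hM hX.2 hlaw h.symm hH.symm ?_).symm
      have hu := h.cover (.vertex (s.onV s.u))
      have hv := h.cover (.vertex (s.onV s.v))
      simp only [Set.insert_subset_iff, Set.singleton_subset_iff, Set.mem_union] at hD ⊢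
      tauto

end Constructed

/-! ### Separation in the moralized graph -/

/-- The gluing topology gives continuity on the closed time interval of the edge; outside it,
`edgePoint` is constant, so it factors through the projection onto that interval. -/
lemma continuous_edgePoint {G : TLG} (e : G.E) : Continuous (G.edgePoint e) := by
  have hc : Continuous fun τ : Set.Icc (G.time (G.src e)) (G.time (G.tgt e)) =>
      G.edgePoint e τ :=
    continuous_iff_coinduced_le.2 (le_iSup (fun e : G.E => TopologicalSpace.coinduced
      (fun τ : Set.Icc (G.time (G.src e)) (G.time (G.tgt e)) => G.edgePoint e τ) inferInstance) e)
  have hle := (G.time_lt e).le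
  have : G.edgePoint e = (fun τ : Set.Icc (G.time (G.src e)) (G.time (G.tgt e)) =>
      G.edgePoint e τ) ∘ Set.projIcc _ _ hle := by
    ext τ
    simp only [Function.comp]
    rcases le_or_gt τ (G.time (G.src e)) with h | h
    · rw [Set.projIcc_of_le_left hle h, edgePoint_of_le h, edgePoint_src]
    rcases le_or_gt (G.time (G.tgt e)) τ with h' | h'
    · rw [Set.projIcc_of_right_le hle h', edgePoint_of_ge h', edgePoint_tgt]
    · rw [Set.projIcc_of_mem hle ⟨h.le, h'.le⟩]
  rw [this]
  exact hc.comp continuous_projIcc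

lemma toMoral_injective (G : TLG) : Function.Injective G.toMoral := by
  rintro (v | ⟨e, τ⟩) (w | ⟨f, τ'⟩) h
  · cases h
    rfl
  · cases h
  · cases h
  · cases h
    rfl

lemma toMoral_edgePoint {G : TLG} (e : G.E) (τ : unitInterval) :
    G.toMoral (G.edgePoint e τ) = G.moral.edgePoint (Sum.inl e) τ := by
  rcases le_or_gt τ (G.time (G.src e)) with h | h
  · rw [edgePoint_of_le h, edgePoint_of_le (G := G.moral) (e := Sum.inl e) h]
    rfl
  rcases le_or_gt (G.time (G.tgt e)) τ with h' | h'
  · rw [edgePoint_of_ge h', edgePoint_of_ge (G := G.moral) (e := Sum.inl e) h']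
    rfl
  · rw [edgePoint_of_mem_Ioo ⟨h, h'⟩,
      edgePoint_of_mem_Ioo (G := G.moral) (e := Sum.inl e) ⟨h, h'⟩]
    rfl

/-- An edge which meets two disjoint open sets leaves their union in between. -/
lemma exists_edgePoint_not_mem {G : TLG} (e : G.E) {U₁ U₂ : Set G.Point} (h₁ : IsOpen U₁)
    (h₂ : IsOpen U₂) (hd : Disjoint U₁ U₂) {a b : unitInterval} (ha : G.edgePoint e a ∈ U₁)
    (hb : G.edgePoint e b ∈ U₂) : ∃ w ∈ Set.uIcc a b, G.edgePoint e w ∉ U₁ ∪ U₂ := by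
  by_contra! hc
  obtain ⟨p, -, hp₁, hp₂⟩ := (isPreconnected_uIcc (a := a) (b := b)) _ _
    (h₁.preimage (continuous_edgePoint e)) (h₂.preimage (continuous_edgePoint e))
    (fun w hw => hc w hw) ⟨a, Set.left_mem_uIcc, ha⟩ ⟨b, Set.right_mem_uIcc, hb⟩
  exact Set.disjoint_left.1 hd hp₁ hp₂

/-- A new edge of the moralized graph does not join two sets which are separated in it by points of
the time-like graph. -/
lemma not_mem_of_cell {G : TLG} {W : Set G.Point} {U₁ U₂ : Set G.moral.Point} (h₁ : IsOpen U₁)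
    (h₂ : IsOpen U₂) (hd : Disjoint U₁ U₂) (hU : U₁ ∪ U₂ = (G.toMoral '' W)ᶜ) {u v : G.V}
    {l₁ l₂ : List G.E} (h : G.IsTrulySimpleCell u v l₁ l₂) (hu : G.toMoral (.vertex u) ∈ U₁)
    (hv : G.toMoral (.vertex v) ∈ U₂) : False := by
  let e : G.moral.E := Sum.inr ⟨(u, v), l₁, l₂, h⟩
  have eu : G.moral.edgePoint e (G.time u) = G.toMoral (.vertex u) :=
    edgePoint_src (G := G.moral) e
  have ev : G.moral.edgePoint e (G.time v) = G.toMoral (.vertex v) :=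
    edgePoint_tgt (G := G.moral) e
  obtain ⟨w, -, hw⟩ := exists_edgePoint_not_mem e h₁ h₂ hd (eu ▸ hu) (ev ▸ hv)
  have hw' := hw
  rw [hU, Set.notMem_compl_iff] at hw'
  obtain ⟨p, -, hp⟩ := hw'
  -- At the ends the edge is in U₁ or U₂. In its interior it contains no point of the original
  -- graph, hence no point of W.
  rcases le_or_gt w (G.time u) with h | h
  · rw [edgePoint_of_le (G := G.moral) (e := e) h] at hw
    exact hw (Or.inl hu)
  rcases le_or_gt (G.time v) w with h' | h'
  · rw [edgePoint_of_ge (G := G.moral) (e := e) h'] at hw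
    exact hw (Or.inr hv)
  · have hp' := hp.trans (edgePoint_of_mem_Ioo (G := G.moral) (e := e) ⟨h, h'⟩)
    rcases p with _ | ⟨f, τ⟩
    · cases hp'
    · have hfe : (Sum.inl f : G.moral.E) = e := (Point.inner.inj hp').1
      exact Sum.inl_ne_inr hfe

/-- The passage from topology to combinatorics: from here on, openness of U₁ and U₂ is needed only
through the connectedness of single edges. -/
lemma separates_of_moral {G : TLG} {W : Set G.Point} {U₁ U₂ : Set G.moral.Point}
    (hW : W.Finite) (h₁ : IsOpen U₁) (h₂ : IsOpen U₂) (hd : Disjoint U₁ U₂)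
    (hU : U₁ ∪ U₂ = (G.toMoral '' W)ᶜ) :
    G.Separates W (G.toMoral ⁻¹' U₁) (G.toMoral ⁻¹' U₂) where
  cover p := by
    by_cases hp : p ∈ W
    · exact Or.inr (Or.inr hp)
    · have : G.toMoral p ∈ U₁ ∪ U₂ := by
        rw [hU]
        rintro ⟨q, hq, hqp⟩
        exact hp (G.toMoral_injective hqp ▸ hq)
      rcases this with h | h
      · exact Or.inl h
      · exact Or.inr (Or.inl h)
  finite e := by
    refine Set.Finite.of_finite_image (hW.subset ?_)
      ((injOn_edgePoint e).mono fun τ hτ => hτ.1)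
    rintro _ ⟨τ, hτ, rfl⟩
    exact hτ.2
  edge e a _ b _ ha hb := by
    rw [Set.mem_preimage, toMoral_edgePoint] at ha hb
    obtain ⟨w, hw, hw'⟩ := exists_edgePoint_not_mem (G := G.moral) (Sum.inl e) h₁ h₂ hd ha hb
    rw [hU, Set.notMem_compl_iff, ← toMoral_edgePoint] at hw'
    obtain ⟨q, hq, hqp⟩ := hw'
    exact ⟨w, hw, G.toMoral_injective hqp ▸ hq⟩
  cell u v l₁ l₂ hc := by
    refine ⟨fun h => not_mem_of_cell h₁ h₂ hd hU hc h.1 h.2, fun h => ?_⟩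
    rw [Set.union_comm] at hU
    exact not_mem_of_cell h₂ h₁ hd.symm hU hc h.1 h.2

end TLG

theorem mainTheorem5 {S : Type*} [MeasurableSpace S] (G : TLG) (hG : G.IsTLGStar)
    (M : G.PathFamily S) (hM : TLG.IsMarkovFamily M)
    {Ω : Type*} [MeasurableSpace Ω] (P : Measure Ω) [IsProbabilityMeasure P]
    (X : G.Point → Ω → S) (hXm : ∀ p, Measurable (X p)) (hX : TLG.IsNaturalProcess P M X) :
    TLG.IsMoralizedGraphMarkovian P X := by
  obtain ⟨T, hT⟩ := hX
  intro W U₁ U₂ hW _ h₁ h₂ _ _ hd hU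
  have h := TLG.Tower.IsConstructed.condIndepOn T hM hXm hT
    (TLG.separates_of_moral hW h₁ h₂ hd hU)
  -- The induction gives independence of the parts in U₁ and U₂; W, being conditioned on, may be
  -- added to both.
  exact (h.union_left hXm).union_right hXm
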